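/- Let $n\ge 2$, let $M$ be a connected smooth manifold of dimension $n+1$, let $\Delta$ be a continuous tangent subbundle of $M$ of rank $n$ (corank $1$), and let $g$ be a continuous metric on $\Delta$. A continuous $1$-form $\eta$ on an open set $V\subset M$ is said to have the continuous exterior differential $d\eta$ if $d\eta$ is a continuous $2$-form on $V$ such that $\int_Y\eta=\int_H d\eta$ for every $1$-cycle $Y$ in $V$ and every $2$-chain $H$ in $V$ with $\partial H=Y$ (chains are formal integer combinations of $C^1$ cells). Suppose that every $p\in M$ has an open neighbourhood $V$ with a continuous $1$-form $\eta$ on $V$ such that 1. $\{\eta\}$ is a basis, over the ring of continuous functions on $V$, of the module of continuous $1$-forms on $V$ that annihilate $\Delta$; 2. $\eta$ has a continuous exterior differential $d\eta$ on $V$; 3. $\Delta$ is non-integrable at $p$, that is, $(\eta\wedge d\eta)_p\neq 0$. Then $\Delta$ is accessible on $M$: for all $p,q\in M$ there is a piecewise $C^1$ path $\gamma:[0,T]\to M$, $T\ge 0$, from $p$ to $q$ with $\dot\gamma(t)\in\Delta_{\gamma(t)}$ and $g(\dot\gamma(t),\dot\gamma(t))=1$ for almost every $t\in[0,T]$. 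-/

import Mathlib

open scoped Manifold ContDiff
open MeasureTheory Set

noncomputable section

namespace ContSubRiem

/-- The model space `ℝᵈ`. -/
abbrev Model (d : ℕ) : Type := EuclideanSpace ℝ (Fin d)

variable {d : ℕ} {M : Type*} [TopologicalSpace M] [ChartedSpace (Model d) M]

/-- Tangent space of the `d`-dimensional manifold `M` at `p`. -/
abbrev Tan (d : ℕ) {M : Type*} [TopologicalSpace M] [ChartedSpace (Model d) M] (p : M) : Type :=
  TangentSpace (𝓡 d) p

section VectorFields

variable [IsManifold (𝓡 d) ∞ M]

/-- Continuity, on the set `W`, of a vector field on `M`, as a section of the tangent bundle. -/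
def ContVectorFieldOn (X : ∀ p : M, Tan d p) (W : Set M) : Prop :=
  ContinuousOn (fun p => (⟨p, X p⟩ : TangentBundle (𝓡 d) M)) W

end VectorFields

/-! ### Continuous differential forms of degree one and two -/

/-- (Not necessarily continuous) differential 1-forms. -/
abbrev OneForm (d : ℕ) (M : Type*) [TopologicalSpace M] [ChartedSpace (Model d) M] :=
  ∀ p : M, Tan d p →L[ℝ] ℝ

/-- (Not necessarily continuous) differential 2-forms. -/
abbrev TwoForm (d : ℕ) (M : Type*) [TopologicalSpace M] [ChartedSpace (Model d) M] :=
  ∀ p : M, (Tan d p) [⋀^Fin 2]→L[ℝ] ℝ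

section Continuity

variable [IsManifold (𝓡 d) ∞ M]

/-- A 1-form is continuous on `V` if its contraction with continuous vector fields defined on
subsets of `V` is continuous. Applied to coordinate frames this is continuity of the
coefficients. -/
def OneForm.ContOn (η : OneForm d M) (V : Set M) : Prop :=
  ∀ W ⊆ V, ∀ X : ∀ p : M, Tan d p, ContVectorFieldOn X W →
    ContinuousOn (fun p => η p (X p)) W

/-- A 2-form is continuous on `V` if its contraction with continuous vector fields defined on
subsets of `V` is continuous. -/
def TwoForm.ContOn (β : TwoForm d M) (V : Set M) : Prop :=
  ∀ W ⊆ V, ∀ X Y : ∀ p : M, Tan d p, ContVectorFieldOn X W → ContVectorFieldOn Y W →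
    ContinuousOn (fun p => β p ![X p, Y p]) W

end Continuity

/-- The value at `p` of the wedge product `η ∧ β` of a 1-form and a 2-form, as a function of three
tangent vectors. -/
def wedge (η : OneForm d M) (β : TwoForm d M) (p : M) (u v w : Tan d p) : ℝ :=
  η p u * β p ![v, w] - η p v * β p ![u, w] + η p w * β p ![u, v]

/-! ### Chains and the Stokes property -/

/-- The unit square `[0,1] × [0,1]`. -/
def unitSquare : Set (ℝ × ℝ) := Icc 0 1 ×ˢ Icc 0 1

/-- A 1-cell in `V`: a `C¹` map `[0,1] → V` (values outside `[0,1]` are irrelevant). -/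
structure Cell1 (d : ℕ) {M : Type*} [TopologicalSpace M] [ChartedSpace (Model d) M]
    (V : Set M) where
  toFun : ℝ → M
  contMDiffOn : ContMDiffOn 𝓘(ℝ, ℝ) (𝓡 d) 1 toFun (Icc 0 1)
  mapsTo : MapsTo toFun (Icc 0 1) V

/-- A 2-cell in `V`: a `C¹` map `[0,1] × [0,1] → V` (values outside the square are irrelevant). -/
structure Cell2 (d : ℕ) {M : Type*} [TopologicalSpace M] [ChartedSpace (Model d) M]
    (V : Set M) where
  toFun : ℝ × ℝ → M
  contMDiffOn : ContMDiffOn 𝓘(ℝ, ℝ × ℝ) (𝓡 d) 1 toFun unitSquare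
  mapsTo : MapsTo toFun unitSquare V

variable {V : Set M}

/-- Restriction of a 2-cell to an edge, parametrized by a smooth map `[0,1] → [0,1] × [0,1]`. -/
def Cell2.edge (σ : Cell2 d V) (e : ℝ → ℝ × ℝ) (he : ContDiff ℝ 1 e)
    (hm : MapsTo e (Icc 0 1) unitSquare) : Cell1 d V where
  toFun := σ.toFun ∘ e
  contMDiffOn := σ.contMDiffOn.comp he.contMDiff.contMDiffOn hm
  mapsTo := σ.mapsTo.comp hm

/-- `t ↦ σ (t, 0)` -/
def Cell2.bottom (σ : Cell2 d V) : Cell1 d V :=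
  σ.edge (fun t => (t, 0)) (by fun_prop) (fun t ht => by simpa [unitSquare] using ht)

/-- `t ↦ σ (t, 1)` -/
def Cell2.top (σ : Cell2 d V) : Cell1 d V :=
  σ.edge (fun t => (t, 1)) (by fun_prop) (fun t ht => by simpa [unitSquare] using ht)

/-- `t ↦ σ (0, t)` -/
def Cell2.left (σ : Cell2 d V) : Cell1 d V :=
  σ.edge (fun t => (0, t)) (by fun_prop) (fun t ht => by simpa [unitSquare] using ht)

/-- `t ↦ σ (1, t)` -/
def Cell2.right (σ : Cell2 d V) : Cell1 d V :=
  σ.edge (fun t => (1, t)) (by fun_prop) (fun t ht => by simpa [unitSquare] using ht)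

/-- 1-chains in `V`: formal integer combinations of 1-cells. -/
abbrev Chain1 (d : ℕ) {M : Type*} [TopologicalSpace M] [ChartedSpace (Model d) M] (V : Set M) :=
  Cell1 d V →₀ ℤ

/-- 2-chains in `V`: formal integer combinations of 2-cells. -/
abbrev Chain2 (d : ℕ) {M : Type*} [TopologicalSpace M] [ChartedSpace (Model d) M] (V : Set M) :=
  Cell2 d V →₀ ℤ

/-- The boundary of a 2-cell, with the counterclockwise orientation. -/
def Cell2.boundary (σ : Cell2 d V) : Chain1 d V :=
  Finsupp.single σ.bottom 1 + Finsupp.single σ.right 1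
    - Finsupp.single σ.top 1 - Finsupp.single σ.left 1

/-- The boundary of a 2-chain. -/
def Chain2.boundary (H : Chain2 d V) : Chain1 d V :=
  H.sum fun σ m => m • σ.boundary

/-- `∫_c η` for a 1-cell `c`. -/
def Cell1.integral (c : Cell1 d V) (η : OneForm d M) : ℝ :=
  ∫ t in Icc (0 : ℝ) 1,
    η (c.toFun t) (mfderivWithin 𝓘(ℝ, ℝ) (𝓡 d) c.toFun (Icc 0 1) t (1 : ℝ))

/-- `∫_σ β` for a 2-cell `σ`. -/
def Cell2.integral (σ : Cell2 d V) (β : TwoForm d M) : ℝ :=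
  ∫ z in unitSquare,
    β (σ.toFun z)
      ![mfderivWithin 𝓘(ℝ, ℝ × ℝ) (𝓡 d) σ.toFun unitSquare z ((1, 0) : ℝ × ℝ),
        mfderivWithin 𝓘(ℝ, ℝ × ℝ) (𝓡 d) σ.toFun unitSquare z ((0, 1) : ℝ × ℝ)]

/-- `∫_Y η` for a 1-chain `Y`. -/
def Chain1.integral (Y : Chain1 d V) (η : OneForm d M) : ℝ :=
  Y.sum fun c m => (m : ℝ) * c.integral η

/-- `∫_H β` for a 2-chain `H`. -/
def Chain2.integral (H : Chain2 d V) (β : TwoForm d M) : ℝ :=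
  H.sum fun σ m => (m : ℝ) * σ.integral β

/-- `β` is a continuous exterior differential on `V` of the continuous 1-form `η`: both forms are
continuous on `V` and `∫_Y η = ∫_H β` for each 1-cycle `Y` of `V` and each 2-chain `H` of `V`
bounded by `Y` (a 1-chain which is a boundary is automatically a cycle). -/
structure IsContExtDifferential [IsManifold (𝓡 d) ∞ M] (η : OneForm d M) (β : TwoForm d M)
    (V : Set M) : Prop where
  cont_form : η.ContOn V
  cont_differential : β.ContOn V
  stokes : ∀ (Y : Chain1 d V) (H : Chain2 d V), Chain2.boundary H = Y →
    Chain1.integral Y η = Chain2.integral H β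

/-! ### Continuous tangent subbundles -/

section Subbundles

variable [IsManifold (𝓡 d) ∞ M]

/-- A continuous tangent subbundle of rank `r` on `M`: a family of subspaces of the tangent spaces
which near each point is spanned by `r` linearly independent continuous vector fields. -/
structure ContSubbundle (d : ℕ) (M : Type*) [TopologicalSpace M] [ChartedSpace (Model d) M]
    [IsManifold (𝓡 d) ∞ M] (r : ℕ) where
  fiber : ∀ p : M, Submodule ℝ (Tan d p)
  exists_frame : ∀ p : M, ∃ U : Set M, IsOpen U ∧ p ∈ U ∧
    ∃ X : Fin r → ∀ q : M, Tan d q, (∀ i, ContVectorFieldOn (X i) U) ∧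
      ∀ q ∈ U, LinearIndependent ℝ (fun i => X i q) ∧
        Submodule.span ℝ (range fun i => X i q) = fiber q

variable {r : ℕ}

/-- `η` belongs to the module of continuous 1-forms on `V` that annihilate `Δ`. -/
def ContSubbundle.IsAnnihilatorForm (Δ : ContSubbundle d M r) (V : Set M) (η : OneForm d M) :
    Prop :=
  η.ContOn V ∧ ∀ q ∈ V, ∀ v ∈ Δ.fiber q, η q v = 0

/-- `{η}` is a basis, over the ring of continuous functions on `V`, of the module of continuous
1-forms on `V` that annihilate `Δ`. -/
structure ContSubbundle.IsAnnihilatorBasis (Δ : ContSubbundle d M r) (V : Set M)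
    (η : OneForm d M) : Prop where
  mem : Δ.IsAnnihilatorForm V η
  linearIndependent : ∀ f : M → ℝ, ContinuousOn f V → (∀ q ∈ V, f q • η q = 0) → ∀ q ∈ V, f q = 0
  spans : ∀ ζ : OneForm d M, Δ.IsAnnihilatorForm V ζ →
    ∃ f : M → ℝ, ContinuousOn f V ∧ ∀ q ∈ V, ζ q = f q • η q

/-- A triple `{V, η, dη}` with which the annihilator of the corank 1 bundle `Δ` is equipped with a
continuous exterior differential at `p`. -/
structure ContSubbundle.ExtDifferentialAt (Δ : ContSubbundle d M r) (p : M) where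
  V : Set M
  isOpen : IsOpen V
  mem : p ∈ V
  η : OneForm d M
  dη : TwoForm d M
  basis : Δ.IsAnnihilatorBasis V η
  isDifferential : IsContExtDifferential η dη V

/-- Non-integrability at `p`: `(η ∧ dη)_p ≠ 0`. -/
def ContSubbundle.ExtDifferentialAt.NonIntegrable {Δ : ContSubbundle d M r} {p : M}
    (D : Δ.ExtDifferentialAt p) : Prop :=
  ∃ u v w : Tan d p, wedge D.η D.dη p u v w ≠ 0

/-- A continuous metric on the bundle `Δ`. -/
structure ContSubbundle.Metric (Δ : ContSubbundle d M r) where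
  form : ∀ p : M, LinearMap.BilinForm ℝ (Δ.fiber p)
  symm : ∀ p v w, form p v w = form p w v
  pos : ∀ p v, v ≠ 0 → 0 < form p v v
  cont : ∀ (W : Set M) (X Y : ∀ p : M, Δ.fiber p),
    ContVectorFieldOn (fun p => (X p : Tan d p)) W →
    ContVectorFieldOn (fun p => (Y p : Tan d p)) W →
      ContinuousOn (fun p => form p (X p) (Y p)) W

/-! ### Admissible paths and accessibility -/

/-- The velocity of a path `γ` at time `t`. -/
def velocity (d : ℕ) {M : Type*} [TopologicalSpace M] [ChartedSpace (Model d) M]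
    (γ : ℝ → M) (t : ℝ) : Tan d (γ t) :=
  mfderiv 𝓘(ℝ, ℝ) (𝓡 d) γ t (1 : ℝ)

/-- `γ` is a piecewise `C¹` path on `[0,T]`: it is continuous, and `[0,T]` is divided into finitely
many closed intervals on each of which `γ` is `C¹`, up to the endpoints. -/
def PiecewiseC1 (d : ℕ) {M : Type*} [TopologicalSpace M] [ChartedSpace (Model d) M]
    (γ : ℝ → M) (T : ℝ) : Prop :=
  ContinuousOn γ (Icc 0 T) ∧
    ∃ (k : ℕ) (τ : ℕ → ℝ), Monotone τ ∧ τ 0 = 0 ∧ τ k = T ∧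
      ∀ i < k, ContMDiffOn 𝓘(ℝ, ℝ) (𝓡 d) 1 γ (Icc (τ i) (τ (i + 1)))

/-- `γ : [0,T] → M` is an admissible path: piecewise `C¹` and tangent to `Δ` almost everywhere. -/
def ContSubbundle.IsAdmissible (Δ : ContSubbundle d M r) (γ : ℝ → M) (T : ℝ) : Prop :=
  PiecewiseC1 d γ T ∧ ∀ᵐ t ∂(volume.restrict (Icc 0 T)), velocity d γ t ∈ Δ.fiber (γ t)

/-- The path `γ : [0,T] → M` is parametrized by length: `g(γ', γ') = 1` almost everywhere. -/
def ContSubbundle.Metric.IsLengthParametrized {Δ : ContSubbundle d M r} (g : Δ.Metric)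
    (γ : ℝ → M) (T : ℝ) : Prop :=
  ∀ᵐ t ∂(volume.restrict (Icc 0 T)), ∃ h : velocity d γ t ∈ Δ.fiber (γ t),
    g.form (γ t) ⟨velocity d γ t, h⟩ ⟨velocity d γ t, h⟩ = 1

/-- `Δ` is accessible on `U`: any two points of `U` are joined by a length parametrized admissible
path. -/
def ContSubbundle.IsAccessibleOn (Δ : ContSubbundle d M r) (g : Δ.Metric) (U : Set M) : Prop :=
  ∀ p ∈ U, ∀ q ∈ U, ∃ (T : ℝ) (γ : ℝ → M), 0 ≤ T ∧ γ 0 = p ∧ γ T = q ∧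
    Δ.IsAdmissible γ T ∧ g.IsLengthParametrized γ T

end Subbundles

end ContSubRiem

end

/-!
Accessibility is an open condition which is checked in charts. Call an arc *unit* if it is `C¹` and
its velocity lies in `Δ` and has length one. If every point of a neighbourhood of each `p` can be
joined with `p`, in both directions, by chains of unit arcs, then the set of points reachable from
`p` is open and closed, hence all of the connected manifold `M`
(`eventually_reflTransGen_unitArc`, `reflTransGen_unitArc`); a chain of unit arcs is concatenated
to a single path in `exists_path_of_reflTransGen`.

Near `p`, everything is pulled back by a chart to an open subset of `E = ℝⁿ⁺¹`
(`IsContExtDifferential.stokesOn_pull`). Let `η` and `B` be the pullbacks of the 1-form and of its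
exterior differential, `y₀` the image of `p`, and choose `e` with `η y₀ e = 1` and `u`, `v` in the
kernel of `η y₀` with `B y₀ u v ≠ 0`; they exist since `η ∧ dη ≠ 0` at `p`. A constant vector `w`
is lifted to the continuous vector field `liftVec η e w` in the kernel of `η` that differs from `w`
by a multiple of `e`. Its integral curves, the *lifts* of `w`, exist by Peano's theorem
(`exists_integralCurve_of_continuous`).

Stokes' formula is only needed for ruled surfaces between two integral curves of the kernel, where
two of the four boundary integrals vanish (`StokesOn.integral_ruledSurface`). It is used twice.

* For two lifts that start close to each other it bounds the distance of the end points by the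
  distance of the initial points and of the lifted vectors (`StokesOn.norm_sub_le`). So lifts are
  unique and depend continuously on the data (`AdaptedBall.exists_liftMap`), although the vector
  fields are merely continuous.
* For the loop which consists of lifts of `s u`, `s v`, `-s u`, `-s v` and starts at `y₀`, the four
  cones with vertex `y₀` over its sides show that the loop does not close when `s > 0` is small: if
  it did, then the integral of `B` over the union of the cones would vanish, but that integral is
  `-s² B y₀ u v + o(s²)` (`AdaptedBall.abs_apply_le_of_closed_loop`).

The end point of such a loop differs from its initial point `y` by a multiple of `e`, which depends
continuously on `s` and `y`. By the intermediate value theorem, loops fill a segment in the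
direction of `e` of length bounded below, on one side of `y`. A point `q` near `y₀` is then reached
by first lifting `q - y₀`, which leads to a point `y'` such that `q - y'` is a small multiple of
`e`, and by a loop from `y'` to `q`, or a reversed loop from `q` to `y'`
(`exists_nhds_liftReachable`). Finally a nonconstant lift is an integral curve of a continuous
nowhere vanishing section of `Δ`, so it can be reparametrized by arc length (`IsLift.unitArc`).
-/

noncomputable section

namespace ContSubRiem

open Filter Topology intervalIntegral

/-! ### Peano's existence theorem -/

section Peano
variable {E : Type*} [NormedAddCommGroup E] [NormedSpace ℝ E]

/-- Solutions of the differential equation `γ' = F ∘ γ` with delayed argument (Tonelli's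
approximations): on each interval of length `ε` the right-hand side only involves earlier values, so
that Picard's iteration stabilizes. -/
theorem exists_delayed_solution {F : E → E} (hF : Continuous F) (y : E) {ε : ℝ} (hε : 0 < ε) :
    ∃ γ : ℝ → E, Continuous γ ∧ (∀ t ≤ 0, γ t = y) ∧
      ∀ t ∈ Icc (0 : ℝ) 1, γ t = y + ∫ s in (0 : ℝ)..t, F (γ (s - ε)) := by
  let step : (ℝ → E) → ℝ → E := fun γ t => y + ∫ s in (0 : ℝ)..max t 0, F (γ (s - ε))
  let it : ℕ → ℝ → E := fun k => step^[k] fun _ => y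
  have hsucc : ∀ k, it (k + 1) = step (it k) := fun k => Function.iterate_succ_apply' _ _ _
  have hcont : ∀ k, Continuous (it k) := by
    intro k
    induction k with
    | zero => exact continuous_const
    | succ k ih =>
      rw [hsucc]
      have hc : Continuous fun s => F (it k (s - ε)) := by fun_prop
      have h2 := continuous_primitive (fun a b => hc.intervalIntegrable (μ := volume) a b) 0
      exact continuous_const.add (h2.comp (by fun_prop : Continuous fun t : ℝ => max t 0))
  have hstable : ∀ (k : ℕ) (t : ℝ), t ≤ k * ε → it (k + 1) t = it k t := by
    intro k
    induction k with
    | zero =>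
      intro t ht
      have : max t 0 = 0 := by simpa using ht
      rw [hsucc]
      simp [step, this, it]
    | succ k ih =>
      intro t ht
      rw [hsucc, hsucc k]
      simp only [step]
      congr 1
      apply intervalIntegral.integral_congr
      intro s hs
      rw [uIcc_of_le (le_max_right _ _)] at hs
      have h0 : 0 ≤ (k : ℝ) * ε := by positivity
      have : s ≤ (k + 1 : ℕ) * ε := hs.2.trans (max_le ht (by positivity))
      simp only
      rw [← ih (s - ε) (by push_cast at this; linarith), hsucc k]
  obtain ⟨k, hk⟩ := exists_nat_gt (1 / ε)
  have hk1 : 1 ≤ k * ε := by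
    rw [div_lt_iff₀ hε] at hk
    exact hk.le
  refine ⟨it k, hcont k, fun t ht => ?_, fun t ht => ?_⟩
  · rw [← hstable k t (by linarith), hsucc]
    simp [step, max_eq_right ht]
  · rw [← hstable k t (by linarith [ht.2]), hsucc]
    simp [step, max_eq_left ht.1]

/-- **Peano's existence theorem** for a bounded continuous vector field. The solution is obtained
by compactness, as a limit of solutions with delays tending to `0`. It is `C¹` on the whole line,
but an integral curve on `[0,1]` only. -/
theorem exists_integralCurve_of_continuous [FiniteDimensional ℝ E] {F : E → E}
    (hF : Continuous F) {C : ℝ} (hC : ∀ x, ‖F x‖ ≤ C) (y : E) :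
    ∃ γ : ℝ → E, ContDiff ℝ 1 γ ∧ γ 0 = y ∧ ∀ t ∈ Icc (0 : ℝ) 1, HasDerivAt γ (F (γ t)) t := by
  have hC0 : 0 ≤ C := (norm_nonneg _).trans (hC y)
  choose γ hγc hγ0 hγ using fun k : ℕ =>
    exists_delayed_solution hF y (ε := 1 / ((k : ℝ) + 1)) (by positivity)
  let I := Icc (0 : ℝ) 1
  let g : ℕ → BoundedContinuousFunction I E := fun k =>
    BoundedContinuousFunction.mkOfCompact ⟨fun t => γ k t, by have := hγc k; fun_prop⟩
  have hgi : ∀ k (t : I), g k t = γ k t := fun k t => rfl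
  have hci : ∀ k a b, IntervalIntegrable (fun s => F (γ k (s - 1 / ((k : ℝ) + 1)))) volume a b :=
    fun k a b => by
      have := hγc k
      exact Continuous.intervalIntegrable (by fun_prop) a b
  have hlip : ∀ k, ∀ s ≤ (1 : ℝ), ∀ t ≤ (1 : ℝ), ‖γ k s - γ k t‖ ≤ C * |s - t| := by
    intro k
    have key : ∀ s ∈ I, ∀ t ∈ I, ‖γ k s - γ k t‖ ≤ C * |s - t| := by
      intro s hs t ht
      rw [hγ k s hs, hγ k t ht, add_sub_add_left_eq_sub, integral_interval_sub_left (hci _ _ _)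
        (hci _ _ _)]
      exact norm_integral_le_of_norm_le_const fun x _ => hC _
    have hmax : ∀ s ≤ (1 : ℝ), γ k s = γ k (max s 0) := by
      intro s _
      rcases le_total s 0 with h | h
      · rw [max_eq_right h, hγ0 k s h, hγ0 k 0 le_rfl]
      · rw [max_eq_left h]
    intro s hs t ht
    rw [hmax s hs, hmax t ht]
    exact (key _ ⟨le_max_right _ _, max_le hs zero_le_one⟩ _
      ⟨le_max_right _ _, max_le ht zero_le_one⟩).trans
      (mul_le_mul_of_nonneg_left (abs_max_sub_max_le_abs s t 0) hC0)
  have hcpt : IsCompact (closure (range g)) := by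
    refine BoundedContinuousFunction.arzela_ascoli (Metric.closedBall y C)
      (isCompact_closedBall y C) _ ?_ ?_
    · rintro _ t ⟨k, rfl⟩
      have h := hlip k t t.2.2 0 zero_le_one
      rw [hγ0 k 0 le_rfl, sub_zero, abs_of_nonneg t.2.1] at h
      rw [mem_closedBall_iff_norm, hgi]
      nlinarith [t.2.2]
    · refine Metric.equicontinuous_of_continuity_modulus (fun x => C * x) ?_ _ ?_
      · have : Tendsto (fun x : ℝ => C * x) (𝓝 0) (𝓝 (C * 0)) :=
          (continuous_const.mul continuous_id).tendsto 0
        simpa using this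
      · rintro s t ⟨_, k, rfl⟩
        simp only [hgi, dist_eq_norm]
        exact hlip k s s.2.2 t t.2.2
  -- a uniform limit of a subsequence satisfies the integral equation without delay
  obtain ⟨f, -, φ, hφ, hlim⟩ := hcpt.tendsto_subseq fun k => subset_closure (mem_range_self k)
  have hpt : ∀ t : I, Tendsto (fun k => γ (φ k) t) atTop (𝓝 (f t)) := fun t =>
    ((BoundedContinuousFunction.tendsto_iff_tendstoUniformly.1 hlim).tendsto_at t)
  let p : ℝ → I := projIcc 0 1 zero_le_one
  let G : ℝ → E := fun t => F (f (p t))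
  have hG : Continuous G := hF.comp (f.continuous.comp continuous_projIcc)
  have hfeq : ∀ t : I, f t = y + ∫ s in (0 : ℝ)..t, G s := by
    intro t
    refine tendsto_nhds_unique (hpt t) ?_
    simp_rw [fun k => hγ (φ k) t t.2]
    refine tendsto_const_nhds.add ?_
    refine tendsto_integral_filter_of_dominated_convergence (fun _ => C) ?_ ?_ ?_ ?_
    · refine Eventually.of_forall fun k => ?_
      have := hγc (φ k)
      exact Continuous.aestronglyMeasurable (by fun_prop)
    · exact Eventually.of_forall fun k => ae_of_all _ fun s _ => hC _
    · exact intervalIntegrable_const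
    · refine ae_of_all _ fun s hs => ?_
      rw [uIoc_of_le t.2.1] at hs
      have hsI : s ∈ I := ⟨hs.1.le, hs.2.trans t.2.2⟩
      refine (hF.tendsto _).comp ?_
      have hps : p s = ⟨s, hsI⟩ := projIcc_of_mem _ hsI
      rw [hps]
      have h1 := hpt ⟨s, hsI⟩
      refine h1.congr_dist ?_
      have h2 : Tendsto (fun k => C * (1 / ((φ k : ℝ) + 1))) atTop (𝓝 (C * 0)) :=
        (tendsto_one_div_add_atTop_nhds_zero_nat.comp hφ.tendsto_atTop).const_mul C
      rw [mul_zero] at h2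
      refine squeeze_zero (fun _ => dist_nonneg) (fun k => ?_) h2
      have hpos : 0 < 1 / ((φ k : ℝ) + 1) := by positivity
      rw [dist_eq_norm]
      refine (hlip (φ k) s hsI.2 _ (by linarith [hsI.2])).trans ?_
      rw [sub_sub_cancel, abs_of_pos hpos]
  refine ⟨fun t => y + ∫ s in (0 : ℝ)..t, G s, ?_, by simp, fun t ht => ?_⟩
  · have hd : ∀ t, HasDerivAt (fun t => y + ∫ s in (0 : ℝ)..t, G s) (G t) t := fun t =>
      (hG.integral_hasStrictDerivAt 0 t).hasDerivAt.const_add y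
    rw [contDiff_one_iff_deriv]
    refine ⟨fun t => (hd t).differentiableAt, ?_⟩
    rw [show deriv _ = G from funext fun t => (hd t).deriv]
    exact hG
  · have h := (hG.integral_hasStrictDerivAt 0 t).hasDerivAt.const_add y
    have h2 : F (y + ∫ s in (0 : ℝ)..t, G s) = G t := by
      rw [← hfeq ⟨t, ht⟩]
      simp only [G, p, projIcc_of_mem _ ht]
    simpa only [h2] using h
end Peano

/-! ### Stokes' formula for ruled surfaces -/

section Patch
variable {E : Type*} [NormedAddCommGroup E] [NormedSpace ℝ E]

/-- `B` is an exterior differential of the 1-form `η` on `Ω` in the sense of Stokes' formula for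
`C¹` maps of the unit square to `Ω`. A 2-form is encoded as a field of bilinear forms; that they are
alternating is not part of this property. -/
def StokesOn (η : E → E →L[ℝ] ℝ) (B : E → E →L[ℝ] E →L[ℝ] ℝ) (Ω : Set E) : Prop :=
  ∀ σ : ℝ × ℝ → E, ContDiff ℝ 1 σ → MapsTo σ unitSquare Ω →
    (∫ t in Icc (0 : ℝ) 1, η (σ (t, 0)) (fderiv ℝ σ (t, 0) (1, 0)))
      + (∫ t in Icc (0 : ℝ) 1, η (σ (1, t)) (fderiv ℝ σ (1, t) (0, 1)))
      - (∫ t in Icc (0 : ℝ) 1, η (σ (t, 1)) (fderiv ℝ σ (t, 1) (1, 0)))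
      - (∫ t in Icc (0 : ℝ) 1, η (σ (0, t)) (fderiv ℝ σ (0, t) (0, 1)))
    = ∫ z in unitSquare, B (σ z) (fderiv ℝ σ z (1, 0)) (fderiv ℝ σ z (0, 1))

/-- The ruled surface formed by the segments from `α t` to `γ t`. -/
def ruledSurface (α γ : ℝ → E) (z : ℝ × ℝ) : E := α z.1 + z.2 • (γ z.1 - α z.1)

theorem contDiff_ruledSurface {α γ : ℝ → E} (hα : ContDiff ℝ 1 α) (hγ : ContDiff ℝ 1 γ) :
    ContDiff ℝ 1 (ruledSurface α γ) := by
  unfold ruledSurface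
  fun_prop

theorem fderiv_ruledSurface {α γ : ℝ → E} (hα : ContDiff ℝ 1 α) (hγ : ContDiff ℝ 1 γ) (z : ℝ × ℝ) :
    fderiv ℝ (ruledSurface α γ) z (1, 0) = deriv α z.1 + z.2 • (deriv γ z.1 - deriv α z.1) ∧
    fderiv ℝ (ruledSurface α γ) z (0, 1) = γ z.1 - α z.1 := by
  have hd : DifferentiableAt ℝ (ruledSurface α γ) z :=
    (contDiff_ruledSurface hα hγ).differentiable one_ne_zero z
  have ha := (hα.differentiable one_ne_zero z.1).hasDerivAt
  have hg := (hγ.differentiable one_ne_zero z.1).hasDerivAt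
  constructor
  · have h1 : HasDerivAt (fun t : ℝ => (t, z.2)) ((1 : ℝ), (0 : ℝ)) z.1 :=
      (hasDerivAt_id z.1).prodMk (hasDerivAt_const z.1 z.2)
    have h2 := hd.hasFDerivAt.comp_hasDerivAt_of_eq z.1 h1 rfl
    exact h2.unique (ha.add ((hg.sub ha).const_smul z.2))
  · have h1 : HasDerivAt (fun t : ℝ => (z.1, t)) ((0 : ℝ), (1 : ℝ)) z.2 :=
      (hasDerivAt_const z.2 z.1).prodMk (hasDerivAt_id z.2)
    have h2 := hd.hasFDerivAt.comp_hasDerivAt_of_eq z.2 h1 rfl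
    have h3 := ((hasDerivAt_id z.2).smul_const (γ z.1 - α z.1)).const_add (α z.1)
    rw [one_smul] at h3
    exact h2.unique h3

/-- Stokes' formula for a ruled surface between two integral curves of the kernel of `η`: only the
two boundary segments contribute to the integral of `η`. -/
theorem StokesOn.integral_ruledSurface {η : E → E →L[ℝ] ℝ} {B : E → E →L[ℝ] E →L[ℝ] ℝ} {Ω : Set E}
    (hS : StokesOn η B Ω) {α γ : ℝ → E} (hα : ContDiff ℝ 1 α) (hγ : ContDiff ℝ 1 γ)
    (hm : MapsTo (ruledSurface α γ) unitSquare Ω)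
    (hηα : ∀ t ∈ Icc (0 : ℝ) 1, η (α t) (deriv α t) = 0)
    (hηγ : ∀ t ∈ Icc (0 : ℝ) 1, η (γ t) (deriv γ t) = 0) :
    (∫ t in Icc (0 : ℝ) 1, η (ruledSurface α γ (1, t)) (γ 1 - α 1))
      - (∫ t in Icc (0 : ℝ) 1, η (ruledSurface α γ (0, t)) (γ 0 - α 0))
    = ∫ z in unitSquare, B (ruledSurface α γ z)
        (deriv α z.1 + z.2 • (deriv γ z.1 - deriv α z.1)) (γ z.1 - α z.1) := by
  have h := hS _ (contDiff_ruledSurface hα hγ) hm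
  simp only [fun z => (fderiv_ruledSurface hα hγ z).1,
    fun z => (fderiv_ruledSurface hα hγ z).2] at h
  rw [← h]
  have e1 : ∫ t in Icc (0 : ℝ) 1, η (ruledSurface α γ (t, 0))
      (deriv α t + (0 : ℝ) • (deriv γ t - deriv α t)) = 0 := by
    refine setIntegral_eq_zero_of_forall_eq_zero fun t ht => ?_
    simpa [ruledSurface] using hηα t ht
  have e2 : ∫ t in Icc (0 : ℝ) 1, η (ruledSurface α γ (t, 1))
      (deriv α t + (1 : ℝ) • (deriv γ t - deriv α t)) = 0 := by
    refine setIntegral_eq_zero_of_forall_eq_zero fun t ht => ?_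
    simpa [ruledSurface] using hηγ t ht
  rw [e1, e2]
  ring

theorem mapsTo_ruledSurface {α γ : ℝ → E} {S : Set E} (hS : Convex ℝ S)
    (hα : ∀ t ∈ Icc (0 : ℝ) 1, α t ∈ S) (hγ : ∀ t ∈ Icc (0 : ℝ) 1, γ t ∈ S) :
    MapsTo (ruledSurface α γ) unitSquare S := fun _ hz =>
  hS.add_smul_sub_mem (hα _ hz.1) (hγ _ hz.1) hz.2

theorem volume_unitSquare : (volume : Measure (ℝ × ℝ)).real unitSquare = 1 := by
  rw [unitSquare, Measure.volume_eq_prod, measureReal_prod_prod]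
  simp

theorem norm_setIntegral_unitSquare_le {f : ℝ × ℝ → ℝ} {C : ℝ}
    (h : ∀ z ∈ unitSquare, ‖f z‖ ≤ C) : ‖∫ z in unitSquare, f z‖ ≤ C := by
  have h1 := norm_setIntegral_le_of_norm_le_const (μ := volume) (s := unitSquare) (f := f)
    (isCompact_Icc.prod isCompact_Icc).measure_lt_top h
  rwa [volume_unitSquare, mul_one] at h1

theorem norm_setIntegral_unitInterval_le {f : ℝ → ℝ} {C : ℝ}
    (h : ∀ t ∈ Icc (0 : ℝ) 1, ‖f t‖ ≤ C) : ‖∫ t in Icc (0 : ℝ) 1, f t‖ ≤ C := by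
  have h1 := norm_setIntegral_le_of_norm_le_const (μ := volume) (s := Icc (0 : ℝ) 1) (f := f)
    isCompact_Icc.measure_lt_top h
  simpa using h1

/-- Two integral curves of the kernel of `η` remain close if they start close to each other and
their projections along `e` remain close. Indeed Stokes' formula for the ruled surface between them
bounds the component of their difference along `e` by its initial value and by the area of the
surface, which is small compared with the largest distance of the curves when the velocities are
small. -/
theorem StokesOn.norm_sub_le {η : E → E →L[ℝ] ℝ} {B : E → E →L[ℝ] E →L[ℝ] ℝ} {S : Set E}
    (hS : StokesOn η B S) (hconv : Convex ℝ S) (hη : ContinuousOn η S)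
    {l : E →L[ℝ] ℝ} {e : E} {ε b R δ : ℝ}
    (hηl : ∀ y ∈ S, ‖η y - l‖ ≤ ε) (hb : ∀ y ∈ S, ‖B y‖ ≤ b)
    (hsmall : ‖e‖ * (ε + b * R) ≤ 1 / 2) {α γ : ℝ → E} (hα : ContDiff ℝ 1 α) (hγ : ContDiff ℝ 1 γ)
    (hαS : ∀ t ∈ Icc (0 : ℝ) 1, α t ∈ S) (hγS : ∀ t ∈ Icc (0 : ℝ) 1, γ t ∈ S)
    (hηα : ∀ t ∈ Icc (0 : ℝ) 1, η (α t) (deriv α t) = 0)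
    (hηγ : ∀ t ∈ Icc (0 : ℝ) 1, η (γ t) (deriv γ t) = 0)
    (hαR : ∀ t ∈ Icc (0 : ℝ) 1, ‖deriv α t‖ ≤ R) (hγR : ∀ t ∈ Icc (0 : ℝ) 1, ‖deriv γ t‖ ≤ R)
    (hδ : ∀ t ∈ Icc (0 : ℝ) 1, ‖(γ t - α t) - l (γ t - α t) • e‖ ≤ δ) :
    ∀ t ∈ Icc (0 : ℝ) 1, ‖γ t - α t‖ ≤ 2 * δ + 2 * ‖e‖ * (‖l‖ + ε) * ‖γ 0 - α 0‖ := by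
  obtain ⟨T, hT, hmax⟩ := isCompact_Icc.exists_isMaxOn (nonempty_Icc.2 (zero_le_one (α := ℝ)))
    ((hγ.continuous.sub hα.continuous).norm.continuousOn)
  have hmax' : ∀ t ∈ Icc (0 : ℝ) 1, ‖γ t - α t‖ ≤ ‖γ T - α T‖ := fun t ht => hmax ht
  -- the ruled surface between the restrictions to `[0,T]`, where the distance is largest at `T`
  set D := ‖γ T - α T‖ with hD
  have hTt : ∀ t ∈ Icc (0 : ℝ) 1, T * t ∈ Icc (0 : ℝ) 1 := fun t ht =>
    ⟨mul_nonneg hT.1 ht.1, mul_le_one₀ hT.2 ht.1 ht.2⟩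
  have hα' : ContDiff ℝ 1 fun t => α (T * t) := by fun_prop
  have hγ' : ContDiff ℝ 1 fun t => γ (T * t) := by fun_prop
  have hdα : ∀ t, deriv (fun t => α (T * t)) t = T • deriv α (T * t) := fun t =>
    deriv_comp_mul_left T α t
  have hdγ : ∀ t, deriv (fun t => γ (T * t)) t = T • deriv γ (T * t) := fun t =>
    deriv_comp_mul_left T γ t
  have hm : MapsTo (ruledSurface (fun t => α (T * t)) fun t => γ (T * t)) unitSquare S :=
    mapsTo_ruledSurface hconv (fun t ht => hαS _ (hTt t ht)) (fun t ht => hγS _ (hTt t ht))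
  have hst := hS.integral_ruledSurface hα' hγ' hm
    (fun t ht => by rw [hdα, map_smul, hηα _ (hTt t ht), smul_zero])
    (fun t ht => by rw [hdγ, map_smul, hηγ _ (hTt t ht), smul_zero])
  set σ := ruledSurface (fun t => α (T * t)) fun t => γ (T * t) with hσ
  simp only [mul_one, mul_zero] at hst
  have h0S := hαS 0 (by simp)
  have hε0 : 0 ≤ ε := (norm_nonneg _).trans (hηl _ h0S)
  have hb0 : 0 ≤ b := (norm_nonneg (B (α 0))).trans (hb _ h0S)
  have hR0 : 0 ≤ R := (norm_nonneg _).trans (hαR 0 (by simp))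
  have hD0 : 0 ≤ D := norm_nonneg _
  have hsq : ∀ t ∈ Icc (0 : ℝ) 1, ((1 : ℝ), t) ∈ unitSquare := fun t ht =>
    ⟨by simp, ht⟩
  have hsq0 : ∀ t ∈ Icc (0 : ℝ) 1, ((0 : ℝ), t) ∈ unitSquare := fun t ht =>
    ⟨by simp, ht⟩
  have hBint : ‖∫ z in unitSquare, B (σ z) (deriv (fun t => α (T * t)) z.1 +
      z.2 • (deriv (fun t => γ (T * t)) z.1 - deriv (fun t => α (T * t)) z.1))
      (γ (T * z.1) - α (T * z.1))‖ ≤ b * R * D := by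
    refine norm_setIntegral_unitSquare_le fun z hz => ?_
    refine ((B (σ z)).le_opNorm₂ _ _).trans ?_
    have h1 : ‖deriv (fun t => α (T * t)) z.1 +
      z.2 • (deriv (fun t => γ (T * t)) z.1 - deriv (fun t => α (T * t)) z.1)‖ ≤ R := by
      have h2 : ∀ x : E, ‖x‖ ≤ R → T • x ∈ Metric.closedBall (0 : E) R := fun x hx => by
        rw [mem_closedBall_zero_iff, norm_smul, Real.norm_of_nonneg hT.1]
        exact (mul_le_of_le_one_left (norm_nonneg _) hT.2).trans hx
      rw [← mem_closedBall_zero_iff, hdα, hdγ]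
      exact (convex_closedBall (0 : E) R).add_smul_sub_mem (h2 _ (hαR _ (hTt _ hz.1)))
        (h2 _ (hγR _ (hTt _ hz.1))) hz.2
    have h3 := hmax' _ (hTt _ hz.1)
    have h4 := hb _ (hm hz)
    gcongr
  have hleft : ‖∫ t in Icc (0 : ℝ) 1, η (σ (0, t)) (γ 0 - α 0)‖ ≤ (‖l‖ + ε) * ‖γ 0 - α 0‖ := by
    refine norm_setIntegral_unitInterval_le fun t ht => ?_
    refine ((η _).le_opNorm _).trans ?_
    have h1 := hηl _ (hm (hsq0 t ht))
    have h2 : ‖η (σ (0, t))‖ ≤ ‖l‖ + ε := by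
      calc ‖η (σ (0, t))‖ = ‖l + (η (σ (0, t)) - l)‖ := by rw [add_sub_cancel]
        _ ≤ _ := (norm_add_le _ _).trans (by gcongr)
    gcongr
  have hright : ‖(∫ t in Icc (0 : ℝ) 1, η (σ (1, t)) (γ T - α T)) - l (γ T - α T)‖ ≤ ε * D := by
    have hint : IntegrableOn (fun t => η (σ (1, t)) (γ T - α T)) (Icc (0 : ℝ) 1) := by
      refine ContinuousOn.integrableOn_compact isCompact_Icc ?_
      refine ContinuousOn.clm_apply (hη.comp ?_ fun t ht => hm (hsq t ht)) continuousOn_const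
      exact ((contDiff_ruledSurface hα' hγ').continuous.comp (by fun_prop)).continuousOn
    have hc : l (γ T - α T) = ∫ t in Icc (0 : ℝ) 1, l (γ T - α T) := by simp
    rw [hc, ← integral_sub hint (by simp)]
    refine norm_setIntegral_unitInterval_le fun t ht => ?_
    rw [← sub_apply]
    exact ((η (σ (1, t)) - l).le_opNorm _).trans
      (mul_le_mul_of_nonneg_right (hηl _ (hm (hsq t ht))) (norm_nonneg _))
  have hl : ‖l (γ T - α T)‖ ≤ ε * D + (‖l‖ + ε) * ‖γ 0 - α 0‖ + b * R * D := by
    simp only [Real.norm_eq_abs, abs_le] at *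
    constructor <;> linarith [hBint.1, hBint.2, hleft.1, hleft.2, hright.1, hright.2]
  have hfin : D ≤ δ + ‖l (γ T - α T)‖ * ‖e‖ := by
    calc D = ‖((γ T - α T) - l (γ T - α T) • e) + l (γ T - α T) • e‖ := by
          rw [sub_add_cancel]
      _ ≤ _ := (norm_add_le _ _).trans (add_le_add (hδ T hT) (norm_smul_le _ _))
  have h5 := mul_le_mul_of_nonneg_right hl (norm_nonneg e)
  have h6 := mul_le_mul_of_nonneg_right hsmall hD0
  intro t ht
  refine (hmax' t ht).trans ?_
  nlinarith
end Patch

/-! ### Lifts of constant vectors -/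

section Lifts
variable {E : Type*} [NormedAddCommGroup E] [NormedSpace ℝ E]

theorem exists_continuous_retraction_closedBall (y₀ : E) {r : ℝ} (hr : 0 < r) :
    ∃ ρ : E → E, Continuous ρ ∧ (∀ y, ρ y ∈ Metric.closedBall y₀ r) ∧
      ∀ y ∈ Metric.closedBall y₀ r, ρ y = y := by
  have hpos : ∀ y : E, 0 < max r ‖y - y₀‖ := fun y => lt_max_of_lt_left hr
  refine ⟨fun y => y₀ + (r / max r ‖y - y₀‖) • (y - y₀), ?_, fun y => ?_, fun y hy => ?_⟩
  · refine continuous_const.add (Continuous.smul ?_ (by fun_prop))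
    exact continuous_const.div (by fun_prop) fun y => (hpos y).ne'
  · rw [mem_closedBall_iff_norm, add_sub_cancel_left, norm_smul,
      Real.norm_of_nonneg (div_nonneg hr.le (hpos y).le), div_mul_eq_mul_div, div_le_iff₀ (hpos y)]
    exact mul_le_mul_of_nonneg_left (le_max_right _ _) hr.le
  · rw [mem_closedBall_iff_norm] at hy
    simp only [max_eq_left hy, div_self hr.ne', one_smul, add_sub_cancel]

/-- The vector in the kernel of `η y` that differs from `w` by a multiple of `e`. This requires
`η y e ≠ 0`. -/
def liftVec (η : E → E →L[ℝ] ℝ) (e w y : E) : E := w - ((η y e)⁻¹ * η y w) • e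

/-- `γ` is a lift of the constant vector `w`: a `C¹` curve which on `[0,1]` is an integral curve of
`liftVec η e w` in `S` from `y` to `y'`. -/
structure IsLift (η : E → E →L[ℝ] ℝ) (e : E) (S : Set E) (w y y' : E) (γ : ℝ → E) : Prop where
  contDiff : ContDiff ℝ 1 γ
  source : γ 0 = y
  target : γ 1 = y'
  mem : ∀ t ∈ Icc (0 : ℝ) 1, γ t ∈ S
  hasDerivAt : ∀ t ∈ Icc (0 : ℝ) 1, HasDerivAt γ (liftVec η e w (γ t)) t

/-- A closed ball around `y₀` on which Stokes' formula holds, the form `η` is positive on `e` and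
`η`, its multiple normalized to be `1` on `e`, and `B` are all `κ`-close to their values at `y₀`. -/
structure AdaptedBall (η : E → E →L[ℝ] ℝ) (B : E → E →L[ℝ] E →L[ℝ] ℝ) (e y₀ : E) (κ r : ℝ) :
    Prop where
  pos : 0 < r
  stokes : StokesOn η B (Metric.closedBall y₀ r)
  cont : ContinuousOn η (Metric.closedBall y₀ r)
  cont_diff : ContinuousOn B (Metric.closedBall y₀ r)
  apply_center : η y₀ e = 1
  transverse : ∀ y ∈ Metric.closedBall y₀ r, 0 < η y e
  norm_form_sub_le : ∀ y ∈ Metric.closedBall y₀ r, ‖η y - η y₀‖ ≤ κ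
  norm_diff_sub_le : ∀ y ∈ Metric.closedBall y₀ r, ‖B y - B y₀‖ ≤ κ
  norm_slope_sub_le : ∀ y ∈ Metric.closedBall y₀ r, ‖(η y e)⁻¹ • η y - η y₀‖ ≤ κ

/-- Adapted balls exist for each closeness `κ > 0`. -/
theorem exists_adaptedBall {η : E → E →L[ℝ] ℝ} {B : E → E →L[ℝ] E →L[ℝ] ℝ} {Ω : Set E}
    (hΩ : IsOpen Ω) (hη : ContinuousOn η Ω) (hB : ContinuousOn B Ω) (hS : StokesOn η B Ω)
    {y₀ e : E} (hy : y₀ ∈ Ω) (he : η y₀ e = 1) {κ : ℝ} (hκ : 0 < κ) :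
    ∃ r, Metric.closedBall y₀ r ⊆ Ω ∧ AdaptedBall η B e y₀ κ r := by
  have hηc : ContinuousAt η y₀ := hη.continuousAt (hΩ.mem_nhds hy)
  have hBc : ContinuousAt B y₀ := hB.continuousAt (hΩ.mem_nhds hy)
  have hec : ContinuousAt (fun y => η y e) y₀ := hηc.clm_apply continuousAt_const
  have hsc : ContinuousAt (fun y => (η y e)⁻¹ • η y) y₀ :=
    (hec.inv₀ (by rw [he]; exact one_ne_zero)).smul hηc
  have h0 : ∀ᶠ y in 𝓝 y₀, y ∈ Ω := hΩ.mem_nhds hy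
  have h1 : ∀ᶠ y in 𝓝 y₀, 0 < η y e := hec.eventually (lt_mem_nhds (he.symm ▸ one_pos : 0 < η y₀ e))
  have h2 := hηc.eventually (Metric.closedBall_mem_nhds _ hκ)
  have h3 := hBc.eventually (Metric.closedBall_mem_nhds (B y₀) hκ)
  have h4 := hsc.eventually (Metric.closedBall_mem_nhds _ hκ)
  obtain ⟨r, hr, h⟩ := Metric.nhds_basis_closedBall.eventually_iff.1
    (h0.and (h1.and (h2.and (h3.and h4))))
  have hsub : Metric.closedBall y₀ r ⊆ Ω := fun y hy => (h hy).1
  refine ⟨r, hsub, hr, fun σ hσ hm => hS σ hσ (hm.mono_right hsub), hη.mono hsub,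
    hB.mono hsub, he,
    fun y hy => (h hy).2.1, fun y hy => ?_, fun y hy => ?_, fun y hy => ?_⟩
  · exact mem_closedBall_iff_norm.1 (h hy).2.2.1
  · exact (dist_eq_norm (B y) (B y₀)).symm.trans_le (h hy).2.2.2.1
  · have := mem_closedBall_iff_norm.1 (h hy).2.2.2.2
    simpa only [he, inv_one, one_smul] using this

variable {η : E → E →L[ℝ] ℝ} {B : E → E →L[ℝ] E →L[ℝ] ℝ} {e y₀ : E} {κ r : ℝ}

namespace AdaptedBall

theorem nonneg (h : AdaptedBall η B e y₀ κ r) : 0 ≤ κ :=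
  (norm_nonneg _).trans (h.norm_form_sub_le y₀ (Metric.mem_closedBall_self h.pos.le))

theorem form_liftVec (h : AdaptedBall η B e y₀ κ r) (w : E) {y : E}
    (hy : y ∈ Metric.closedBall y₀ r) : η y (liftVec η e w y) = 0 := by
  have := (h.transverse y hy).ne'
  simp only [liftVec, map_sub, map_smul, smul_eq_mul]
  field_simp
  ring

theorem norm_liftVec_sub_le (h : AdaptedBall η B e y₀ κ r) (w : E) {y : E}
    (hy : y ∈ Metric.closedBall y₀ r) :
    ‖liftVec η e w y - (w - η y₀ w • e)‖ ≤ κ * ‖w‖ * ‖e‖ := by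
  have h1 : liftVec η e w y - (w - η y₀ w • e) = -((((η y e)⁻¹ • η y - η y₀) w) • e) := by
    simp only [liftVec, sub_apply, smul_apply, smul_eq_mul, sub_smul]
    abel
  rw [h1, norm_neg, norm_smul]
  gcongr
  exact ((_ : E →L[ℝ] ℝ).le_opNorm w).trans
    (mul_le_mul_of_nonneg_right (h.norm_slope_sub_le y hy) (norm_nonneg _))

theorem norm_liftVec_le (h : AdaptedBall η B e y₀ κ r) (w : E) {y : E}
    (hy : y ∈ Metric.closedBall y₀ r) :
    ‖liftVec η e w y‖ ≤ (1 + (‖η y₀‖ + κ) * ‖e‖) * ‖w‖ := by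
  calc ‖liftVec η e w y‖ = ‖(liftVec η e w y - (w - η y₀ w • e)) + (w - η y₀ w • e)‖ := by
        rw [sub_add_cancel]
    _ ≤ κ * ‖w‖ * ‖e‖ + (‖w‖ + ‖η y₀‖ * ‖w‖ * ‖e‖) := by
        refine (norm_add_le _ _).trans (add_le_add (h.norm_liftVec_sub_le w hy) ?_)
        refine (_root_.norm_sub_le _ _).trans (add_le_add le_rfl ?_)
        rw [norm_smul]
        exact mul_le_mul_of_nonneg_right ((η y₀).le_opNorm w) (norm_nonneg _)
    _ = _ := by ring

theorem continuousOn_liftVec (h : AdaptedBall η B e y₀ κ r) (w : E) :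
    ContinuousOn (liftVec η e w) (Metric.closedBall y₀ r) := by
  have h1 : ∀ x : E, ContinuousOn (fun y => η y x) (Metric.closedBall y₀ r) := fun x =>
    h.cont.clm_apply continuousOn_const
  exact continuousOn_const.sub
    ((((h1 e).inv₀ fun y hy => (h.transverse y hy).ne').mul (h1 w)).smul continuousOn_const)

end AdaptedBall

namespace IsLift

variable {w y y' : E} {γ : ℝ → E}

theorem reverse {S : Set E} (hγ : IsLift η e S w y y' γ) :
    IsLift η e S (-w) y' y fun t => γ (1 - t) where
  contDiff := hγ.contDiff.comp (contDiff_const.sub contDiff_id)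
  source := by simpa using hγ.target
  target := by simpa using hγ.source
  mem t ht := hγ.mem _ ⟨by linarith [ht.2], by linarith [ht.1]⟩
  hasDerivAt t ht := by
    have h1 := (hγ.hasDerivAt (1 - t) ⟨by linarith [ht.2], by linarith [ht.1]⟩).comp_const_sub 1 t
    convert h1 using 1
    simp only [liftVec, map_neg, mul_neg, neg_smul]
    abel

theorem deriv_eq {S : Set E} (hγ : IsLift η e S w y y' γ) {t : ℝ} (ht : t ∈ Icc (0 : ℝ) 1) :
    deriv γ t = liftVec η e w (γ t) := (hγ.hasDerivAt t ht).deriv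

theorem form_deriv (h : AdaptedBall η B e y₀ κ r)
    (hγ : IsLift η e (Metric.closedBall y₀ r) w y y' γ) {t : ℝ} (ht : t ∈ Icc (0 : ℝ) 1) :
    η (γ t) (deriv γ t) = 0 := by
  rw [hγ.deriv_eq ht, h.form_liftVec w (hγ.mem t ht)]

/-- A lift stays close to a straight line with velocity `x` if its velocities are close to `x`. -/
theorem norm_sub_le {S : Set E} (hγ : IsLift η e S w y y' γ) {x : E} {C : ℝ}
    (hC : ∀ p ∈ S, ‖liftVec η e w p - x‖ ≤ C) {t : ℝ} (ht : t ∈ Icc (0 : ℝ) 1) :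
    ‖γ t - y - t • x‖ ≤ C := by
  have hd : ∀ s ∈ Icc (0 : ℝ) 1, HasDerivWithinAt (fun s => γ s - s • x)
      (liftVec η e w (γ s) - x) (Icc 0 1) s := fun s hs => by
    have h1 := (hγ.hasDerivAt s hs).sub ((hasDerivAt_id s).smul_const x)
    rw [one_smul] at h1
    exact h1.hasDerivWithinAt
  have h2 := norm_image_sub_le_of_norm_deriv_le_segment' hd
    (fun s hs => hC _ (hγ.mem s (Ico_subset_Icc_self hs))) t ht
  have hC0 : 0 ≤ C := (norm_nonneg _).trans (hC _ (hγ.mem t ht))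
  simp only [zero_smul, sub_zero, hγ.source] at h2
  rw [sub_right_comm]
  exact h2.trans (mul_le_of_le_one_right hC0 ht.2)

theorem norm_sub_source_le (h : AdaptedBall η B e y₀ κ r)
    (hγ : IsLift η e (Metric.closedBall y₀ r) w y y' γ) {t : ℝ} (ht : t ∈ Icc (0 : ℝ) 1) :
    ‖γ t - y‖ ≤ (1 + (‖η y₀‖ + κ) * ‖e‖) * ‖w‖ := by
  have h1 := hγ.norm_sub_le (x := 0) (fun p hp => by
    rw [sub_zero]; exact h.norm_liftVec_le w hp) ht
  simpa using h1

/-- Modulo multiples of `e`, a lift of `w` is a straight line with velocity `w`. -/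
theorem sub_smul_eq (he : η y₀ e = 1) {S : Set E}
    (hγ : IsLift η e S w y y' γ) {t : ℝ} (ht : t ∈ Icc (0 : ℝ) 1) :
    γ t - η y₀ (γ t) • e = (y + t • w) - η y₀ (y + t • w) • e := by
  let P : E →L[ℝ] E := ContinuousLinearMap.id ℝ E - (η y₀).smulRight e
  have hP : ∀ x, P x = x - η y₀ x • e := fun x => rfl
  have hd : ∀ s ∈ Icc (0 : ℝ) 1, HasDerivWithinAt (fun s => P (γ s - s • w)) 0 (Icc 0 1) s := by
    intro s hs
    have h1 := (hγ.hasDerivAt s hs).sub ((hasDerivAt_id s).smul_const w)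
    have h2 := P.hasFDerivAt.comp_hasDerivAt s h1
    refine HasDerivAt.hasDerivWithinAt ?_
    refine h2.congr_deriv ?_
    rw [one_smul, liftVec, sub_sub_cancel_left, map_neg, map_smul, hP, he, one_smul, sub_self,
      smul_zero, neg_zero]
  have h3 := norm_image_sub_le_of_norm_deriv_le_segment' (C := 0) hd (fun s _ => by simp) t ht
  rw [zero_mul, norm_le_zero_iff, sub_eq_zero] at h3
  simp only [zero_smul, sub_zero, hγ.source, map_sub] at h3
  rw [← hP, ← hP, map_add, ← h3, sub_add_cancel]

end IsLift

/-- Lifts exist as long as their length is too small for them to leave the ball. -/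
theorem AdaptedBall.exists_isLift [FiniteDimensional ℝ E] (h : AdaptedBall η B e y₀ κ r) {w y : E}
    (hy : ‖y - y₀‖ + (1 + (‖η y₀‖ + κ) * ‖e‖) * ‖w‖ ≤ r) :
    ∃ y' γ, IsLift η e (Metric.closedBall y₀ r) w y y' γ := by
  -- Peano's theorem is applied to the vector field extended to `E` by a retraction on the ball
  obtain ⟨ρ, hρc, hρm, hρ⟩ := exists_continuous_retraction_closedBall y₀ h.pos
  have hF : Continuous fun x => liftVec η e w (ρ x) :=
    (h.continuousOn_liftVec w).comp_continuous hρc hρm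
  obtain ⟨γ, hγ, hγ0, hγd⟩ := exists_integralCurve_of_continuous hF
    (fun x => h.norm_liftVec_le w (hρm x)) y
  have hmem : ∀ t ∈ Icc (0 : ℝ) 1, γ t ∈ Metric.closedBall y₀ r := fun t ht => by
    have h2 := norm_image_sub_le_of_norm_deriv_le_segment'
      (fun s hs => (hγd s hs).hasDerivWithinAt)
      (fun s _ => h.norm_liftVec_le w (hρm (γ s))) t ht
    rw [hγ0, sub_zero] at h2
    have hC0 : 0 ≤ (1 + (‖η y₀‖ + κ) * ‖e‖) * ‖w‖ := by
      have := h.nonneg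
      positivity
    rw [mem_closedBall_iff_norm]
    calc ‖γ t - y₀‖ = ‖(y - y₀) + (γ t - y)‖ := by congr 1; abel
      _ ≤ _ := (norm_add_le _ _).trans
        (add_le_add le_rfl (h2.trans (mul_le_of_le_one_right hC0 ht.2)))
      _ ≤ r := hy
  refine ⟨γ 1, γ, hγ, hγ0, rfl, hmem, fun t ht => ?_⟩
  have := hγd t ht
  rwa [hρ _ (hmem t ht)] at this

/-- The end point of a lift is a Lipschitz function of the initial point and of the lifted vector.
In particular it is unique. -/
theorem IsLift.norm_target_sub_le (h : AdaptedBall η B e y₀ κ r) {R : ℝ}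
    (hsmall : ‖e‖ * (κ + (‖B y₀‖ + κ) * R) ≤ 1 / 2)
    {w₁ w₂ y₁ y₂ z₁ z₂ : E} {γ₁ γ₂ : ℝ → E}
    (h₁ : IsLift η e (Metric.closedBall y₀ r) w₁ y₁ z₁ γ₁)
    (h₂ : IsLift η e (Metric.closedBall y₀ r) w₂ y₂ z₂ γ₂)
    (hw₁ : (1 + (‖η y₀‖ + κ) * ‖e‖) * ‖w₁‖ ≤ R) (hw₂ : (1 + (‖η y₀‖ + κ) * ‖e‖) * ‖w₂‖ ≤ R) :
    ‖z₂ - z₁‖ ≤ 4 * (1 + (‖η y₀‖ + κ) * ‖e‖) * (‖y₂ - y₁‖ + ‖w₂ - w₁‖) := by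
  have hκ := h.nonneg
  have hB : ∀ y ∈ Metric.closedBall y₀ r, ‖B y‖ ≤ ‖B y₀‖ + κ := fun y hy => by
    have h1 := norm_add_le (B y₀) (B y - B y₀)
    rw [add_sub_cancel (B y₀) (B y)] at h1
    exact h1.trans (add_le_add le_rfl (h.norm_diff_sub_le y hy))
  have key := h.stokes.norm_sub_le (convex_closedBall _ _) h.cont (e := e)
    (δ := (1 + (‖η y₀‖ + κ) * ‖e‖) * (‖y₂ - y₁‖ + ‖w₂ - w₁‖))
    h.norm_form_sub_le hB hsmall h₁.contDiff h₂.contDiff h₁.mem h₂.mem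
    (fun t ht => h₁.form_deriv h ht) (fun t ht => h₂.form_deriv h ht)
    (fun t ht => by rw [h₁.deriv_eq ht]; exact (h.norm_liftVec_le _ (h₁.mem t ht)).trans hw₁)
    (fun t ht => by rw [h₂.deriv_eq ht]; exact (h.norm_liftVec_le _ (h₂.mem t ht)).trans hw₂)
    (fun t ht => ?_) 1 (by simp)
  · rw [h₁.source, h₂.source, h₁.target, h₂.target] at key
    have h3 := norm_nonneg (w₂ - w₁)
    have h4 : 0 ≤ (‖η y₀‖ + κ) * ‖e‖ := by positivity
    nlinarith [norm_nonneg (y₂ - y₁), mul_nonneg h4 h3]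
  · set x := (y₂ - y₁) + t • (w₂ - w₁) with hx
    have h5 : (γ₂ t - γ₁ t) - η y₀ (γ₂ t - γ₁ t) • e = x - η y₀ x • e := by
      have e1 := h₁.sub_smul_eq h.apply_center ht
      have e2 := h₂.sub_smul_eq h.apply_center ht
      calc (γ₂ t - γ₁ t) - η y₀ (γ₂ t - γ₁ t) • e
          = (γ₂ t - η y₀ (γ₂ t) • e) - (γ₁ t - η y₀ (γ₁ t) • e) := by
            rw [map_sub, sub_smul]; abel
        _ = _ := by
            rw [e1, e2, hx]
            simp only [map_add, map_sub, map_smul, smul_sub, add_smul, sub_smul]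
            abel
    have hxn : ‖x‖ ≤ ‖y₂ - y₁‖ + ‖w₂ - w₁‖ := by
      refine (norm_add_le _ _).trans (add_le_add le_rfl ?_)
      rw [norm_smul, Real.norm_of_nonneg ht.1]
      exact mul_le_of_le_one_left (norm_nonneg _) ht.2
    rw [h5]
    calc ‖x - η y₀ x • e‖ ≤ ‖x‖ + ‖η y₀‖ * ‖x‖ * ‖e‖ := by
          refine (_root_.norm_sub_le _ _).trans (add_le_add le_rfl ?_)
          rw [norm_smul]
          exact mul_le_mul_of_nonneg_right ((η y₀).le_opNorm x) (norm_nonneg _)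
      _ ≤ ‖x‖ + (‖η y₀‖ + κ) * ‖x‖ * ‖e‖ := by gcongr; linarith
      _ = (1 + (‖η y₀‖ + κ) * ‖e‖) * ‖x‖ := by ring
      _ ≤ _ := by gcongr

end Lifts

/-! ### Small loops do not close -/

section Loops
variable {E : Type*} [NormedAddCommGroup E] [NormedSpace ℝ E]
  {η : E → E →L[ℝ] ℝ} {B : E → E →L[ℝ] E →L[ℝ] ℝ} {e y₀ : E} {κ r : ℝ}

/-- The integral of `η` along the segment from `y₀` to `y`. -/
def segmentIntegral (η : E → E →L[ℝ] ℝ) (y₀ y : E) : ℝ :=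
  ∫ t in Icc (0 : ℝ) 1, η (y₀ + t • (y - y₀)) (y - y₀)

theorem segmentIntegral_self (η : E → E →L[ℝ] ℝ) (y₀ : E) : segmentIntegral η y₀ y₀ = 0 := by
  simp [segmentIntegral]

/-- The constant in the estimate of the integral of `B` over a cone. -/
def coneConst (e : E) (β : E →L[ℝ] E →L[ℝ] ℝ) : ℝ :=
  (1 + ‖e‖) * (3 + 4 * ‖e‖) + ‖β‖ * ‖e‖ * (3 + 4 * ‖e‖) + 4 * ‖β‖ * ‖e‖

theorem setIntegral_unitSquare_snd : ∫ z in unitSquare, z.2 = (1 / 2 : ℝ) := by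
  have h := setIntegral_prod_mul (μ := (volume : Measure ℝ)) (ν := (volume : Measure ℝ))
    (fun _ : ℝ => (1 : ℝ)) (fun t : ℝ => t) (Icc 0 1) (Icc 0 1)
  simp only [one_mul] at h
  rw [unitSquare, Measure.volume_eq_prod, h]
  rw [integral_Icc_eq_integral_Ioc (f := fun t : ℝ => t), ← integral_of_le zero_le_one, integral_id]
  simp

/-- The integral of `B` over the cone with vertex `y₀` over a lift of `w` that starts near `y₀ + c`
is, up to an error of second order, the one over the cone over the straight segment from `y₀ + c` to
`y₀ + c + w`. By Stokes' formula it is the difference of the segment integrals to the two end points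
of the lift. -/
theorem AdaptedBall.abs_segmentIntegral_sub_le (h : AdaptedBall η B e y₀ κ r) (hκ : κ ≤ 1)
    {μ : ℝ} {w c y y' : E} {γ : ℝ → E} (hBw : B y₀ w w = 0)
    (hγ : IsLift η e (Metric.closedBall y₀ r) w y y' γ) (hw : η y₀ w = 0) (hwμ : ‖w‖ ≤ μ)
    (hy : ‖y - y₀ - c‖ ≤ 3 * (κ * μ * ‖e‖)) (hc : ‖c‖ ≤ 2 * μ) :
    |segmentIntegral η y₀ y' - segmentIntegral η y₀ y - 1 / 2 * B y₀ w c|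
      ≤ κ * μ ^ 2 * coneConst e (B y₀) := by
  have hκ0 := h.nonneg
  have hμ0 : 0 ≤ μ := (norm_nonneg _).trans hwμ
  have hy0 : y₀ ∈ Metric.closedBall y₀ r := Metric.mem_closedBall_self h.pos.le
  have hm := mapsTo_ruledSurface (convex_closedBall y₀ r) (fun _ _ => hy0) hγ.mem
  have hst := h.stokes.integral_ruledSurface (contDiff_const (c := y₀)) hγ.contDiff hm
    (fun t _ => by rw [deriv_const, map_zero]) (fun t ht => hγ.form_deriv h ht)
  set σ := ruledSurface (fun _ => y₀) γ with hσ
  simp only [deriv_const', sub_zero, zero_add] at hst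
  have hst' : segmentIntegral η y₀ y' - segmentIntegral η y₀ y =
      ∫ z in unitSquare, B (σ z) (z.2 • deriv γ z.1) (γ z.1 - y₀) := by
    rw [← hst, hγ.source, hγ.target]
    simp only [segmentIntegral, hσ, ruledSurface, hγ.source, hγ.target]
  have hint : IntegrableOn (fun z : ℝ × ℝ => B (σ z) (z.2 • deriv γ z.1) (γ z.1 - y₀))
      unitSquare := by
    refine ContinuousOn.integrableOn_compact (isCompact_Icc.prod isCompact_Icc) ?_
    have hc1 : Continuous (deriv γ) := hγ.contDiff.continuous_deriv le_rfl
    have hc2 := hγ.contDiff.continuous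
    refine ContinuousOn.clm_apply (ContinuousOn.clm_apply (h.cont_diff.comp ?_ hm) ?_) ?_
    · exact (contDiff_ruledSurface contDiff_const hγ.contDiff).continuous.continuousOn
    · exact Continuous.continuousOn (by fun_prop)
    · exact Continuous.continuousOn (by fun_prop)
  have hint2 : IntegrableOn (fun z : ℝ × ℝ => z.2 * B y₀ w c) unitSquare :=
    ContinuousOn.integrableOn_compact (isCompact_Icc.prod isCompact_Icc)
      (Continuous.continuousOn (by fun_prop))
  have h2 : 1 / 2 * B y₀ w c = ∫ z in unitSquare, z.2 * B y₀ w c := by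
    rw [MeasureTheory.integral_mul_const, setIntegral_unitSquare_snd]
  rw [hst', h2, ← integral_sub hint hint2, ← Real.norm_eq_abs]
  refine norm_setIntegral_unitSquare_le fun z hz => ?_
  have hz1 : z.1 ∈ Icc (0 : ℝ) 1 := hz.1
  have hz2 : z.2 ∈ Icc (0 : ℝ) 1 := hz.2
  -- the velocity of the lift is close to `w`, its displacement from `y₀` is close to `c + t w`
  set x := deriv γ z.1 with hx
  set p := γ z.1 - y₀ with hp
  have hlw : ∀ q ∈ Metric.closedBall y₀ r, ‖liftVec η e w q - w‖ ≤ κ * μ * ‖e‖ := fun q hq => by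
    have h3 := h.norm_liftVec_sub_le w hq
    rw [hw, zero_smul, sub_zero] at h3
    exact h3.trans (by gcongr)
  have hxw : ‖x - w‖ ≤ κ * μ * ‖e‖ := by
    rw [hx, hγ.deriv_eq hz1]
    exact hlw _ (hγ.mem _ hz1)
  have hpc : ‖p - (c + z.1 • w)‖ ≤ 4 * (κ * μ * ‖e‖) := by
    have h4 := hγ.norm_sub_le hlw hz1
    have h5 : p - (c + z.1 • w) = (y - y₀ - c) + (γ z.1 - y - z.1 • w) := by rw [hp]; abel
    rw [h5]
    exact (norm_add_le _ _).trans (by linarith)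
  have he0 := norm_nonneg e
  have hb0 := norm_nonneg (B y₀)
  have hκe : κ * μ * ‖e‖ ≤ μ * ‖e‖ := by nlinarith [mul_nonneg hμ0 he0]
  have hxn : ‖x‖ ≤ μ * (1 + ‖e‖) := by
    have := norm_add_le (x - w) w
    rw [sub_add_cancel] at this
    linarith
  have hcw : ‖c + z.1 • w‖ ≤ 3 * μ := by
    have h6 : ‖z.1 • w‖ ≤ μ := by
      rw [norm_smul, Real.norm_of_nonneg hz1.1]
      exact (mul_le_of_le_one_left (norm_nonneg _) hz1.2).trans hwμ
    exact (norm_add_le _ _).trans (by linarith)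
  have hpn : ‖p‖ ≤ μ * (3 + 4 * ‖e‖) := by
    have := norm_add_le (p - (c + z.1 • w)) (c + z.1 • w)
    rw [sub_add_cancel] at this
    linarith
  have hsplit : B (σ z) (z.2 • x) p - z.2 * B y₀ w c =
      z.2 * ((B (σ z) - B y₀) x p + B y₀ (x - w) p + B y₀ w (p - (c + z.1 • w))) := by
    simp only [map_smul, map_sub, map_add, smul_apply, sub_apply, smul_eq_mul, hBw]
    ring
  rw [hsplit, norm_mul, Real.norm_of_nonneg hz2.1]
  refine (mul_le_of_le_one_left (norm_nonneg _) hz2.2).trans ?_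
  have t1 : ‖(B (σ z) - B y₀) x p‖ ≤ κ * (μ * (1 + ‖e‖)) * (μ * (3 + 4 * ‖e‖)) := by
    refine ((B (σ z) - B y₀).le_opNorm₂ x p).trans ?_
    have := h.norm_diff_sub_le _ (hm hz)
    gcongr
  have t2 : ‖B y₀ (x - w) p‖ ≤ ‖B y₀‖ * (κ * μ * ‖e‖) * (μ * (3 + 4 * ‖e‖)) :=
    ((B y₀).le_opNorm₂ _ _).trans (by gcongr)
  have t3 : ‖B y₀ w (p - (c + z.1 • w))‖ ≤ ‖B y₀‖ * μ * (4 * (κ * μ * ‖e‖)) :=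
    ((B y₀).le_opNorm₂ _ _).trans (by gcongr)
  refine (norm_add₃_le.trans (add_le_add (add_le_add t1 t2) t3)).trans (le_of_eq ?_)
  rw [coneConst]
  ring

/-- If the loop made of lifts of `u`, `v`, `-u`, `-v` closes, then `B y₀ u v` is small compared with
the square of the size `μ` of the loop: the segment integrals of the four cones with vertex `y₀`
over its sides add up to zero, while their first approximations add up to `-B y₀ u v`. -/
theorem AdaptedBall.abs_apply_le_of_closed_loop (h : AdaptedBall η B e y₀ κ r) (hκ : κ ≤ 1)
    (hB : ∀ x, B y₀ x x = 0) {μ : ℝ} {u v z₁ z₂ z₃ : E} {γ₁ γ₂ γ₃ γ₄ : ℝ → E}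
    (h₁ : IsLift η e (Metric.closedBall y₀ r) u y₀ z₁ γ₁)
    (h₂ : IsLift η e (Metric.closedBall y₀ r) v z₁ z₂ γ₂)
    (h₃ : IsLift η e (Metric.closedBall y₀ r) (-u) z₂ z₃ γ₃)
    (h₄ : IsLift η e (Metric.closedBall y₀ r) (-v) z₃ y₀ γ₄)
    (hu : η y₀ u = 0) (hv : η y₀ v = 0) (huμ : ‖u‖ ≤ μ) (hvμ : ‖v‖ ≤ μ) :
    |B y₀ u v| ≤ 4 * (κ * μ ^ 2 * coneConst e (B y₀)) := by
  have hκ0 := h.nonneg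
  have hμ0 : 0 ≤ μ := (norm_nonneg _).trans huμ
  have hk0 : 0 ≤ κ * μ * ‖e‖ := by positivity
  have hlw : ∀ w, η y₀ w = 0 → ‖w‖ ≤ μ → ∀ q ∈ Metric.closedBall y₀ r,
      ‖liftVec η e w q - w‖ ≤ κ * μ * ‖e‖ := fun w hw hwμ q hq => by
    have h3 := h.norm_liftVec_sub_le w hq
    rw [hw, zero_smul, sub_zero] at h3
    exact h3.trans (by gcongr)
  have hone : (1 : ℝ) ∈ Icc (0 : ℝ) 1 := by simp
  have d₁ := h₁.norm_sub_le (hlw u hu huμ) hone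
  have d₂ := h₂.norm_sub_le (hlw v hv hvμ) hone
  have d₃ := h₃.norm_sub_le (hlw (-u) (by rw [map_neg, hu, neg_zero]) (by rwa [norm_neg])) hone
  rw [h₁.target, one_smul] at d₁
  rw [h₂.target, one_smul] at d₂
  rw [h₃.target, one_smul] at d₃
  have q₂ : ‖z₂ - y₀ - (u + v)‖ ≤ 2 * (κ * μ * ‖e‖) := by
    have : z₂ - y₀ - (u + v) = (z₁ - y₀ - u) + (z₂ - z₁ - v) := by abel
    rw [this]
    exact (norm_add_le _ _).trans (by linarith)
  have q₃ : ‖z₃ - y₀ - v‖ ≤ 3 * (κ * μ * ‖e‖) := by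
    have : z₃ - y₀ - v = (z₂ - y₀ - (u + v)) + (z₃ - z₂ - -u) := by abel
    rw [this]
    exact (norm_add_le _ _).trans (by linarith)
  have c₁ := h.abs_segmentIntegral_sub_le hκ (μ := μ) (c := 0) (hB u) h₁ hu huμ
    (by simp only [sub_self, norm_zero]; positivity) (by simp only [norm_zero]; positivity)
  have c₂ := h.abs_segmentIntegral_sub_le hκ (μ := μ) (c := u) (hB v) h₂ hv hvμ
    (by linarith) (by linarith)
  have c₃ := h.abs_segmentIntegral_sub_le hκ (μ := μ) (c := u + v) (hB (-u)) h₃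
    (by rw [map_neg, hu, neg_zero]) (by rwa [norm_neg])
    (by linarith) ((norm_add_le _ _).trans (by linarith))
  have c₄ := h.abs_segmentIntegral_sub_le hκ (μ := μ) (c := v) (hB (-v)) h₄
    (by rw [map_neg, hv, neg_zero]) (by rwa [norm_neg]) q₃ (by linarith)
  have hvu : B y₀ v u = -B y₀ u v := by
    have := hB (u + v)
    simp only [map_add, add_apply, hB] at this
    linarith
  simp only [map_neg, neg_apply, map_add, hB, hvu, map_zero, segmentIntegral_self] at c₁ c₂ c₃ c₄
  rw [abs_le] at *
  constructor <;> linarith [c₁.1, c₁.2, c₂.1, c₂.2, c₃.1, c₃.2, c₄.1, c₄.2]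

end Loops

/-! ### Local reachability in the model space -/

section LocalReachability
variable {E : Type*} [NormedAddCommGroup E] [NormedSpace ℝ E]
  {η : E → E →L[ℝ] ℝ} {B : E → E →L[ℝ] E →L[ℝ] ℝ} {e y₀ : E} {κ r : ℝ}

/-- `LiftReachable η e S y y'`: a chain of lifts of constant vectors in `S` leads from `y` to
`y'`. -/
def LiftReachable (η : E → E →L[ℝ] ℝ) (e : E) (S : Set E) : E → E → Prop :=
  Relation.ReflTransGen fun y y' => ∃ w γ, IsLift η e S w y y' γ

theorem LiftReachable.symm {S : Set E} {y y' : E} (h : LiftReachable η e S y y') :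
    LiftReachable η e S y' y :=
  have : Std.Symm fun y y' : E => ∃ w γ, IsLift η e S w y y' γ :=
    ⟨fun _ _ ⟨w, _, hγ⟩ => ⟨-w, _, hγ.reverse⟩⟩
  Relation.ReflTransGen.stdSymm.symm _ _ h

/-- For initial points near `y₀` and small vectors `w` the end point of the lift of `w` is given by
a continuous map. -/
theorem AdaptedBall.exists_liftMap [FiniteDimensional ℝ E] (h : AdaptedBall η B e y₀ κ r)
    (hκe : ‖e‖ * κ ≤ 1 / 4) :
    ∃ ρ > 0, ∃ C > 0, ∃ Φ : E → E → E,
      (∀ w y, ‖w‖ ≤ ρ → ‖y - y₀‖ ≤ ρ →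
        (∃ γ, IsLift η e (Metric.closedBall y₀ r) w y (Φ w y) γ) ∧ ‖Φ w y - y‖ ≤ C * ‖w‖) ∧
      ContinuousOn (fun x : E × E => Φ x.1 x.2)
        (Metric.closedBall 0 ρ ×ˢ Metric.closedBall y₀ ρ) := by
  have hκ0 := h.nonneg
  set C := 1 + (‖η y₀‖ + κ) * ‖e‖ with hC
  have hC1 : 1 ≤ C := by
    rw [hC]
    have : 0 ≤ (‖η y₀‖ + κ) * ‖e‖ := by positivity
    linarith
  have hC0 : 0 < C := by linarith
  set R := 1 / (4 * (‖e‖ * (‖B y₀‖ + κ) + 1)) with hR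
  have hb : 0 ≤ ‖e‖ * (‖B y₀‖ + κ) := by positivity
  have hR0 : 0 < R := by positivity
  have hsmall : ‖e‖ * (κ + (‖B y₀‖ + κ) * R) ≤ 1 / 2 := by
    have h1 : ‖e‖ * (‖B y₀‖ + κ) * R ≤ 1 / 4 := by
      rw [hR, mul_one_div, div_le_iff₀ (by positivity)]
      linarith
    linarith
  set ρ := min (r / 2) R / C with hρ
  have hr := h.pos
  have hρ0 : 0 < ρ := by positivity
  have hρC : C * ρ = min (r / 2) R := by rw [hρ]; field_simp
  have hρr : ρ ≤ r / 2 := by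
    have : ρ ≤ C * ρ := le_mul_of_one_le_left hρ0.le hC1
    exact this.trans (hρC.le.trans (min_le_left _ _))
  have hex : ∀ w y, ‖w‖ ≤ ρ → ‖y - y₀‖ ≤ ρ →
      ∃ y' γ, IsLift η e (Metric.closedBall y₀ r) w y y' γ := fun w y hw hy => by
    refine h.exists_isLift ?_
    have h1 : C * ‖w‖ ≤ C * ρ := by gcongr
    have h2 := hρC ▸ min_le_left (r / 2) R
    linarith
  choose! Φ γ hΦ using hex
  have hwR : ∀ w : E, ‖w‖ ≤ ρ → C * ‖w‖ ≤ R := fun w hw => by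
    have h1 : C * ‖w‖ ≤ C * ρ := by gcongr
    exact h1.trans (hρC.le.trans (min_le_right _ _))
  refine ⟨ρ, hρ0, C, hC0, Φ, fun w y hw hy => ⟨⟨_, hΦ w y hw hy⟩, ?_⟩, ?_⟩
  · have h1 := (hΦ w y hw hy).norm_sub_source_le h (t := 1) (by simp)
    rwa [(hΦ w y hw hy).target] at h1
  · refine (LipschitzOnWith.of_dist_le_mul (K := (8 * C).toNNReal) ?_).continuousOn
    rintro ⟨w, y⟩ ⟨hw, hy⟩ ⟨w', y'⟩ ⟨hw', hy'⟩
    simp only [mem_closedBall_iff_norm, sub_zero] at hw hy hw' hy'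
    rw [Real.coe_toNNReal _ (by positivity), dist_eq_norm]
    refine ((hΦ w' y' hw' hy').norm_target_sub_le h hsmall (hΦ w y hw hy) (hwR _ hw')
      (hwR _ hw)).trans ?_
    have h1 : ‖y - y'‖ ≤ dist (w, y) (w', y') := by
      rw [← dist_eq_norm]; exact le_max_right _ _
    have h2 : ‖w - w'‖ ≤ dist (w, y) (w', y') := by
      rw [← dist_eq_norm]; exact le_max_left _ _
    nlinarith

/-- If `B y₀` does not vanish on the kernel of `η y₀`, then all points near `y₀` can be reached from
`y₀` by chains of lifts. -/
theorem exists_nhds_liftReachable [FiniteDimensional ℝ E] {Ω : Set E}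
    (hΩ : IsOpen Ω) (hη : ContinuousOn η Ω) (hBc : ContinuousOn B Ω) (hS : StokesOn η B Ω)
    (hy : y₀ ∈ Ω) (he : η y₀ e = 1) (hB : ∀ x, B y₀ x x = 0) {u v : E}
    (hu : η y₀ u = 0) (hv : η y₀ v = 0) (huv : B y₀ u v ≠ 0) :
    ∃ S ⊆ Ω, (∀ y ∈ S, 0 < η y e) ∧ ∀ᶠ q in 𝓝 y₀, LiftReachable η e S y₀ q := by
  set μ := max ‖u‖ ‖v‖ with hμ
  have huμ : ‖u‖ ≤ μ := le_max_left _ _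
  have hvμ : ‖v‖ ≤ μ := le_max_right _ _
  have hμ0 : 0 < μ := by
    refine lt_of_lt_of_le (norm_pos_iff.2 ?_) huμ
    rintro rfl
    simp at huv
  have hK0 : 0 ≤ coneConst e (B y₀) := by unfold coneConst; positivity
  -- the last condition on `κ` prevents small loops with directions `u` and `v` from closing
  obtain ⟨κ, hκ0, hκ1, hκe, hκB⟩ : ∃ κ > 0, κ ≤ 1 ∧ ‖e‖ * κ ≤ 1 / 4 ∧
      4 * (κ * μ ^ 2 * coneConst e (B y₀)) < |B y₀ u v| := by
    have l0 : ∀ᶠ κ in 𝓝[>] (0 : ℝ), 0 < κ := self_mem_nhdsWithin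
    have l1 : ∀ᶠ κ in 𝓝[>] (0 : ℝ), κ ≤ 1 :=
      nhdsWithin_le_nhds (Iic_mem_nhds one_pos)
    have l2 : ∀ᶠ κ in 𝓝[>] (0 : ℝ), ‖e‖ * κ ≤ 1 / 4 := by
      refine nhdsWithin_le_nhds ?_
      exact (by fun_prop : Continuous fun κ : ℝ => ‖e‖ * κ).tendsto' 0 0 (by simp) |>.eventually
        (Iic_mem_nhds (by norm_num : (0 : ℝ) < 1 / 4))
    have l3 : ∀ᶠ κ in 𝓝[>] (0 : ℝ), 4 * (κ * μ ^ 2 * coneConst e (B y₀)) < |B y₀ u v| := by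
      refine nhdsWithin_le_nhds ?_
      exact (by fun_prop : Continuous fun κ : ℝ => 4 * (κ * μ ^ 2 * coneConst e (B y₀))).tendsto'
        0 0 (by simp) |>.eventually (Iio_mem_nhds (abs_pos.2 huv))
    obtain ⟨κ, h0, h1, h2, h3⟩ := (l0.and (l1.and (l2.and l3))).exists
    exact ⟨κ, h0, h1, h2, h3⟩
  obtain ⟨r, hrΩ, h⟩ := exists_adaptedBall hΩ hη hBc hS hy he hκ0
  refine ⟨_, hrΩ, h.transverse, ?_⟩
  obtain ⟨ρ, hρ, C, hC, Φ, hΦ, hΦc⟩ := h.exists_liftMap hκe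
  have hreach : ∀ w y, ‖w‖ ≤ ρ → ‖y - y₀‖ ≤ ρ →
      LiftReachable η e (Metric.closedBall y₀ r) y (Φ w y) := fun w y hw hy =>
    Relation.ReflTransGen.single ⟨w, (hΦ w y hw hy).1⟩
  -- `s₀` is so small that four successive lifts of vectors of norm at most `s₀ μ` which start in
  -- the ball of radius `ρ / 2` stay in the ball of radius `ρ`
  obtain ⟨s₀, hs₀, hs₁, hs₂⟩ : ∃ s₀ > 0, s₀ * μ ≤ ρ ∧ 4 * (C * (s₀ * μ)) ≤ ρ / 2 := by
    refine ⟨min (ρ / μ) (ρ / (8 * C * μ)), by positivity, ?_, ?_⟩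
    · rw [← le_div_iff₀ hμ0]; exact min_le_left _ _
    · have := min_le_right (ρ / μ) (ρ / (8 * C * μ))
      rw [le_div_iff₀ (by positivity)] at this
      linarith
  have hws : ∀ w : E, ‖w‖ ≤ μ → ∀ s ∈ Icc 0 s₀, ‖s • w‖ ≤ s₀ * μ := fun w hw s hs => by
    rw [norm_smul, Real.norm_of_nonneg hs.1]
    exact mul_le_mul hs.2 hw (norm_nonneg _) hs₀.le
  set P := Icc (0 : ℝ) s₀ ×ˢ Metric.closedBall y₀ (ρ / 2) with hP
  -- one side of the loop, after a part of the loop which is described by `f`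
  have hside : ∀ (w : E), ‖w‖ ≤ μ → ∀ (f : ℝ × E → E) (k : ℝ), k + C * (s₀ * μ) ≤ ρ →
      ContinuousOn f P → (∀ x ∈ P, ‖f x - y₀‖ ≤ k) →
      ContinuousOn (fun x => Φ (x.1 • w) (f x)) P ∧
      (∀ x ∈ P, ‖Φ (x.1 • w) (f x) - y₀‖ ≤ k + C * (s₀ * μ)) ∧
      ∀ x ∈ P, ∃ γ, IsLift η e (Metric.closedBall y₀ r) (x.1 • w) (f x) (Φ (x.1 • w) (f x)) γ := by
    intro w hw f k hk hf hfk
    have hkρ : k ≤ ρ := by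
      have : 0 ≤ C * (s₀ * μ) := by positivity
      linarith
    have hwx : ∀ x ∈ P, ‖x.1 • w‖ ≤ s₀ * μ := fun x hx => hws w hw _ hx.1
    have hΦx : ∀ x ∈ P, _ := fun x hx =>
      hΦ (x.1 • w) (f x) ((hwx x hx).trans hs₁) ((hfk x hx).trans hkρ)
    refine ⟨hΦc.comp (f := fun x : ℝ × E => (x.1 • w, f x)) ?_ fun x hx => ⟨?_, ?_⟩, fun x hx => ?_,
      fun x hx => (hΦx x hx).1⟩
    · exact ContinuousOn.prodMk (Continuous.continuousOn (by fun_prop)) hf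
    · rw [mem_closedBall_zero_iff]
      exact (hwx x hx).trans hs₁
    · rw [mem_closedBall_iff_norm]
      exact (hfk x hx).trans hkρ
    · have h1 := norm_add_le (f x - y₀) (Φ (x.1 • w) (f x) - f x)
      rw [add_comm, sub_add_sub_cancel] at h1
      have h2 : C * ‖x.1 • w‖ ≤ C * (s₀ * μ) := by
        have := hwx x hx
        gcongr
      linarith [hfk x hx, (hΦx x hx).2]
  have hCs : 0 ≤ C * (s₀ * μ) := by positivity
  obtain ⟨a₁, b₁, g₁⟩ := hside u huμ (fun x => x.2) (ρ / 2) (by linarith) continuousOn_snd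
    fun x hx => mem_closedBall_iff_norm.1 hx.2
  obtain ⟨a₂, b₂, g₂⟩ := hside v hvμ _ _ (by linarith) a₁ b₁
  obtain ⟨a₃, b₃, g₃⟩ := hside (-u) (by rwa [norm_neg]) _ _ (by linarith) a₂ b₂
  obtain ⟨a₄, b₄, g₄⟩ := hside (-v) (by rwa [norm_neg]) _ _ (by linarith) a₃ b₃
  set L : ℝ × E → E := fun x => Φ (x.1 • -v) (Φ (x.1 • -u) (Φ (x.1 • v) (Φ (x.1 • u) x.2))) with hL
  have hLreach : ∀ x ∈ P, LiftReachable η e (Metric.closedBall y₀ r) x.2 (L x) := fun x hx =>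
    Relation.ReflTransGen.head ⟨_, g₁ x hx⟩ (Relation.ReflTransGen.head ⟨_, g₂ x hx⟩
      (Relation.ReflTransGen.head ⟨_, g₃ x hx⟩ (Relation.ReflTransGen.single ⟨_, g₄ x hx⟩)))
  set f : ℝ × E → ℝ := fun x => η y₀ (L x - x.2) with hf
  have hfc : ContinuousOn f P := (η y₀).continuous.comp_continuousOn (a₄.sub continuousOn_snd)
  have hone : (1 : ℝ) ∈ Icc (0 : ℝ) 1 := by simp
  have hLf : ∀ x ∈ P, L x = x.2 + f x • e := fun x hx => by
    obtain ⟨γ₁, k₁⟩ := g₁ x hx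
    obtain ⟨γ₂, k₂⟩ := g₂ x hx
    obtain ⟨γ₃, k₃⟩ := g₃ x hx
    obtain ⟨γ₄, k₄⟩ := g₄ x hx
    have j₁ := k₁.sub_smul_eq he hone
    have j₂ := k₂.sub_smul_eq he hone
    have j₃ := k₃.sub_smul_eq he hone
    have j₄ := k₄.sub_smul_eq he hone
    rw [k₁.target] at j₁
    rw [k₂.target] at j₂
    rw [k₃.target] at j₃
    rw [k₄.target] at j₄
    simp only [one_smul, map_add, map_smul, map_neg, hu, hv, neg_zero, smul_zero, add_zero]
      at j₁ j₂ j₃ j₄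
    rw [add_sub_right_comm, j₃, add_sub_right_comm, j₂, add_sub_right_comm, j₁] at j₄
    change L x - η y₀ (L x) • e = _ at j₄
    rw [sub_eq_iff_eq_add] at j₄
    rw [j₄, hf]
    simp only [map_sub, sub_smul, smul_neg]
    abel
  have hcenter : (s₀, y₀) ∈ P := ⟨⟨hs₀.le, le_rfl⟩, Metric.mem_closedBall_self (by linarith)⟩
  have hf0 : f (s₀, y₀) ≠ 0 := by
    intro h0
    obtain ⟨γ₁, k₁⟩ := g₁ _ hcenter
    obtain ⟨γ₂, k₂⟩ := g₂ _ hcenter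
    obtain ⟨γ₃, k₃⟩ := g₃ _ hcenter
    obtain ⟨γ₄, k₄⟩ := g₄ _ hcenter
    have hcl := hLf _ hcenter
    rw [h0, zero_smul, add_zero] at hcl
    change IsLift η e _ _ _ (L (s₀, y₀)) γ₄ at k₄
    rw [hcl] at k₄
    simp only [smul_neg] at k₃ k₄
    have hss : s₀ ∈ Icc 0 s₀ := ⟨hs₀.le, le_rfl⟩
    have := h.abs_apply_le_of_closed_loop hκ1 hB k₁ k₂ k₃ k₄ (by simp [hu]) (by simp [hv])
      (hws u huμ s₀ hss) (hws v hvμ s₀ hss)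
    simp only [map_smul, smul_apply, smul_eq_mul, abs_mul, abs_of_pos hs₀] at this
    have hsq : 0 < s₀ * s₀ := by positivity
    nlinarith
  -- every height between `0` and the height of the loop of size `s₀` is attained
  have hivt : ∀ y, ‖y - y₀‖ ≤ ρ / 2 → ∀ τ ∈ uIcc 0 (f (s₀, y)),
      LiftReachable η e (Metric.closedBall y₀ r) y (y + τ • e) := by
    intro y hy τ hτ
    have hyP : ∀ s ∈ Icc 0 s₀, (s, y) ∈ P := fun s hs => ⟨hs, mem_closedBall_iff_norm.2 hy⟩
    have hstart : f (0, y) = 0 := by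
      have hΦ0 : ∀ z, ‖z - y₀‖ ≤ ρ → Φ 0 z = z := fun z hz => by
        have := (hΦ 0 z (by simpa using hρ.le) hz).2
        rwa [norm_zero, mul_zero, norm_le_zero_iff, sub_eq_zero] at this
      have := hΦ0 y (by linarith)
      simp only [hf, hL, zero_smul, this, sub_self, map_zero]
    have hcs : ContinuousOn (fun s => f (s, y)) (uIcc 0 s₀) := by
      rw [uIcc_of_le hs₀.le]
      exact hfc.comp (Continuous.continuousOn (by fun_prop)) hyP
    have hsub := intermediate_value_uIcc hcs
    simp only [hstart] at hsub
    obtain ⟨s, hs, hsτ⟩ := hsub hτ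
    rw [uIcc_of_le hs₀.le] at hs
    have h1 := hLreach _ (hyP s hs)
    rw [hLf _ (hyP s hs)] at h1
    simp only at hsτ
    rwa [hsτ] at h1
  have hfs : ContinuousAt (fun y => f (s₀, y)) y₀ := by
    have h1 : ContinuousOn (fun y => f (s₀, y)) (Metric.closedBall y₀ (ρ / 2)) :=
      hfc.comp (Continuous.continuousOn (by fun_prop)) fun y hy => ⟨⟨hs₀.le, le_rfl⟩, hy⟩
    exact h1.continuousAt (Metric.closedBall_mem_nhds _ (by linarith))
  have hlarge : ∀ᶠ y in 𝓝 y₀, |f (s₀, y) - f (s₀, y₀)| < |f (s₀, y₀)| / 2 ∧ ‖y - y₀‖ ≤ ρ / 2 := by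
    refine (hfs.eventually (Metric.ball_mem_nhds _ (half_pos (abs_pos.2 hf0)))).and ?_
    filter_upwards [Metric.closedBall_mem_nhds y₀ (half_pos hρ)] with y hy
    exact mem_closedBall_iff_norm.1 hy
  -- the end point of the lift of `q - y₀` from `y₀` differs from `q` by a multiple of `e`
  have hρ0 : ‖y₀ - y₀‖ ≤ ρ := by simpa using hρ.le
  have hqρ : ∀ᶠ q in 𝓝 y₀, ‖q - y₀‖ ≤ ρ := by
    filter_upwards [Metric.closedBall_mem_nhds y₀ hρ] with y hy
    exact mem_closedBall_iff_norm.1 hy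
  have hlim : Tendsto (fun q => Φ (q - y₀) y₀) (𝓝 y₀) (𝓝 y₀) := by
    rw [tendsto_iff_norm_sub_tendsto_zero]
    refine squeeze_zero' (Eventually.of_forall fun _ => norm_nonneg _)
      (hqρ.mono fun q hq => (hΦ _ _ hq hρ0).2) ?_
    have : Continuous fun q : E => C * ‖q - y₀‖ := by fun_prop
    exact this.tendsto' _ _ (by simp)
  have hτlim : Tendsto (fun q => η y₀ (q - Φ (q - y₀) y₀)) (𝓝 y₀) (𝓝 0) := by
    refine ((η y₀).continuous.tendsto' 0 0 (map_zero _)).comp ?_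
    simpa using tendsto_id.sub hlim
  filter_upwards [hqρ, hlarge, hlim.eventually hlarge,
    hτlim.eventually (Metric.ball_mem_nhds _ (half_pos (abs_pos.2 hf0)))] with q hq hq1 hq2 hq3
  set y' := Φ (q - y₀) y₀ with hy'
  set τ := η y₀ (q - y') with hτ
  rw [Real.dist_eq, sub_zero] at hq3
  have hqy : q = y' + τ • e := by
    obtain ⟨γ, k⟩ := (hΦ _ _ hq hρ0).1
    have j := k.sub_smul_eq he hone
    rw [k.target, one_smul, add_sub_cancel] at j
    rw [hτ, map_sub, sub_smul, sub_eq_iff_eq_add.1 j.symm]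
    simp only [map_add, map_sub, map_smul, he, add_smul, sub_smul, smul_eq_mul, mul_one]
    abel
  have hfirst := hreach _ _ hq hρ0
  rw [← hy'] at hfirst
  have hcases : τ ∈ uIcc 0 (f (s₀, y')) ∨ -τ ∈ uIcc 0 (f (s₀, q)) := by
    simp only [mem_uIcc]
    have e1 := abs_lt.1 hq1.1
    have e2 := abs_lt.1 hq2.1
    have e3 := abs_lt.1 hq3
    rcases lt_or_gt_of_ne hf0 with hneg | hpos
    · rw [abs_of_neg hneg] at e1 e2 e3
      rcases le_total τ 0 with ht | ht
      · exact Or.inl (Or.inr ⟨by linarith, ht⟩)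
      · exact Or.inr (Or.inr ⟨by linarith, by linarith⟩)
    · rw [abs_of_pos hpos] at e1 e2 e3
      rcases le_total τ 0 with ht | ht
      · exact Or.inr (Or.inl ⟨by linarith, by linarith⟩)
      · exact Or.inl (Or.inl ⟨ht, by linarith⟩)
  refine hfirst.trans ?_
  rcases hcases with hc | hc
  · have := hivt y' hq2.2 τ hc
    rwa [← hqy] at this
  · have := (hivt q hq1.2 (-τ) hc).symm
    rwa [show q + -τ • e = y' by rw [neg_smul, hqy]; abel] at this

end LocalReachability

/-! ### Pullback to charts -/

section Charts
variable {d : ℕ} {M : Type*} [TopologicalSpace M] [ChartedSpace (Model d) M]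
  [IsManifold (𝓡 d) ∞ M]

/-- The isomorphism from the model space to the tangent space at `q` defined by the chart at `p`. It
has a junk value for `q` outside the domain of the chart. -/
def chartFrame (p q : M) : Model d →L[ℝ] Tan d q :=
  (trivializationAt (Model d) (TangentSpace (𝓡 d)) p).symmL ℝ q

/-- The local parametrization of `M` that is inverse to the chart at `p`. -/
def chartParam (d : ℕ) {M : Type*} [TopologicalSpace M] [ChartedSpace (Model d) M] (p : M) :
    Model d → M := (extChartAt (𝓡 d) p).symm

theorem contVectorFieldOn_chartFrame (p : M) {W : Set M} {F : M → Model d}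
    (hW : W ⊆ (chartAt (Model d) p).source) (hF : ContinuousOn F W) :
    ContVectorFieldOn (fun q => chartFrame p q (F q)) W := by
  have h := (trivializationAt (Model d) (TangentSpace (𝓡 d)) p).continuousOn_symm.comp
    (f := fun q => (q, F q)) (s := W) (continuousOn_id.prodMk hF)
    (fun q hq => ⟨by simpa using hW hq, mem_univ _⟩)
  refine h.congr fun q hq => ?_
  have hb : q ∈ (trivializationAt (Model d) (TangentSpace (𝓡 d)) p).baseSet := by
    simpa using hW hq
  simp only [chartFrame, Function.comp_apply, Bundle.Trivialization.symmL_apply _ hb]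

theorem chartFrame_injective (p : M) {q : M} (hq : q ∈ (chartAt (Model d) p).source) :
    Function.Injective (chartFrame (d := d) p q) := by
  have hb : q ∈ (trivializationAt (Model d) (TangentSpace (𝓡 d)) p).baseSet := by
    simpa using hq
  exact Function.LeftInverse.injective (g :=
    (trivializationAt (Model d) (TangentSpace (𝓡 d)) p).continuousLinearMapAt ℝ q)
    fun v => Bundle.Trivialization.continuousLinearMapAt_symmL _ hb v

theorem chartFrame_surjective (p : M) {q : M} (hq : q ∈ (chartAt (Model d) p).source) :
    Function.Surjective (chartFrame (d := d) p q) := by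
  have hb : q ∈ (trivializationAt (Model d) (TangentSpace (𝓡 d)) p).baseSet := by
    simpa using hq
  intro v
  exact ⟨(trivializationAt (Model d) (TangentSpace (𝓡 d)) p).continuousLinearMapAt ℝ q v,
    Bundle.Trivialization.symmL_continuousLinearMapAt _ hb v⟩

omit [IsManifold (𝓡 d) ∞ M] in
theorem chartParam_mem_source (p : M) {y : Model d} (hy : y ∈ (extChartAt (𝓡 d) p).target) :
    chartParam d p y ∈ (chartAt (Model d) p).source := by
  rw [← extChartAt_source (𝓡 d)]
  exact (extChartAt (𝓡 d) p).map_target hy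

theorem contMDiffOn_chartParam (p : M) :
    ContMDiffOn 𝓘(ℝ, Model d) (𝓡 d) 1 (chartParam d p) (extChartAt (𝓡 d) p).target :=
  (contMDiffOn_extChartAt_symm (n := ∞) p).of_le (by exact_mod_cast le_top)

/-- The derivative of the local parametrization is given by the trivialization of the tangent
bundle, for which continuity of sections is available. -/
theorem hasMFDerivAt_chartParam (p : M) {y : Model d} (hy : y ∈ (extChartAt (𝓡 d) p).target) :
    HasMFDerivAt 𝓘(ℝ, Model d) (𝓡 d) (chartParam d p) y
      (chartFrame p (chartParam d p y) : Model d →L[ℝ] Tan d (chartParam d p y)) := by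
  have : IsManifold (𝓡 d) 1 M := IsManifold.of_le (n := ∞) (by exact_mod_cast le_top)
  have h1 := mdifferentiableWithinAt_extChartAt_symm (I := 𝓡 d) hy
  have h2 := h1.hasMFDerivWithinAt.hasMFDerivAt
    (by rw [ModelWithCorners.range_eq_univ]; exact univ_mem)
  have h3 := TangentBundle.symmL_trivializationAt (𝕜 := ℝ) (I := 𝓡 d) (chartParam_mem_source p hy)
  have h4 : extChartAt (𝓡 d) p (chartParam d p y) = y := (extChartAt (𝓡 d) p).right_inv hy
  rw [h4] at h3
  exact h2.congr_mfderiv h3.symm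

/-- The pullback of a 1-form by the local parametrization at `p`. -/
def OneForm.pull (η : OneForm d M) (p : M) (y : Model d) : Model d →L[ℝ] ℝ :=
  (η (chartParam d p y)).comp (chartFrame p (chartParam d p y))

/-- The bilinear form defined by an alternating form in two variables. -/
def bilinOfAlternating (b : (Model d) [⋀^Fin 2]→L[ℝ] ℝ) : Model d →L[ℝ] Model d →L[ℝ] ℝ :=
  have h0 : ∀ u v x : Model d, Function.update ![u, v] 0 x = ![x, v] := fun u v x => by
    funext i; fin_cases i <;> rfl
  have h1 : ∀ u v x : Model d, Function.update ![u, v] 1 x = ![u, x] := fun u v x => by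
    funext i; fin_cases i <;> rfl
  (LinearMap.mk₂ ℝ (fun u v => b ![u, v])
    (fun u u' v => by simpa only [h0] using b.map_update_add ![u, v] 0 u u')
    (fun c u v => by simpa only [h0] using b.map_update_smul ![u, v] 0 c u)
    (fun u v v' => by simpa only [h1] using b.map_update_add ![u, v] 1 v v')
    (fun c u v => by
      simpa only [h1] using b.map_update_smul ![u, v] 1 c v)).toContinuousBilinearMap

theorem bilinOfAlternating_apply (b : (Model d) [⋀^Fin 2]→L[ℝ] ℝ) (u v : Model d) :
    bilinOfAlternating b u v = b ![u, v] := rfl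

/-- The pullback of a 2-form by the local parametrization at `p`, as a field of bilinear forms. -/
def TwoForm.pull (β : TwoForm d M) (p : M) (y : Model d) : Model d →L[ℝ] Model d →L[ℝ] ℝ :=
  bilinOfAlternating ((β (chartParam d p y)).compContinuousLinearMap
    (chartFrame p (chartParam d p y)))

theorem TwoForm.pull_apply (β : TwoForm d M) (p : M) (y u v : Model d) :
    β.pull p y u v = β (chartParam d p y)
      ![chartFrame p (chartParam d p y) u, chartFrame p (chartParam d p y) v] := by
  rw [TwoForm.pull, bilinOfAlternating_apply,
    ContinuousAlternatingMap.compContinuousLinearMap_apply]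
  congr 1
  ext i : 1
  fin_cases i <;> rfl

/-- The image in the chart at `p` of the part of `V` in the domain of the chart. -/
def chartDomain (p : M) (V : Set M) : Set (Model d) :=
  (extChartAt (𝓡 d) p).target ∩ chartParam d p ⁻¹' V

omit [IsManifold (𝓡 d) ∞ M] in
theorem isOpen_chartDomain (p : M) {V : Set M} (hV : IsOpen V) :
    IsOpen (chartDomain (d := d) p V) :=
  (continuousOn_extChartAt_symm p).isOpen_inter_preimage (isOpen_extChartAt_target p) hV

omit [IsManifold (𝓡 d) ∞ M] in
theorem mapsTo_chartDomain (p : M) (V : Set M) :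
    MapsTo (chartParam d p) (chartDomain p V) (V ∩ (chartAt (Model d) p).source) :=
  fun _ hy => ⟨hy.2, chartParam_mem_source p hy.1⟩

omit [IsManifold (𝓡 d) ∞ M] in
theorem continuousOn_chartParam (p : M) (V : Set M) :
    ContinuousOn (chartParam d p) (chartDomain p V) :=
  (continuousOn_extChartAt_symm p).mono inter_subset_left

theorem OneForm.ContOn.pull {η : OneForm d M} {V : Set M} (hη : η.ContOn V) (p : M) :
    ContinuousOn (η.pull p) (chartDomain p V) := by
  rw [continuousOn_clm_apply]
  intro u
  exact (hη _ inter_subset_left _ (contVectorFieldOn_chartFrame p inter_subset_right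
    (continuousOn_const (c := u)))).comp (continuousOn_chartParam p V) (mapsTo_chartDomain p V)

theorem TwoForm.ContOn.pull {β : TwoForm d M} {V : Set M} (hβ : β.ContOn V) (p : M) :
    ContinuousOn (β.pull p) (chartDomain p V) := by
  rw [continuousOn_clm_apply]
  intro u
  rw [continuousOn_clm_apply]
  intro v
  simp only [TwoForm.pull_apply]
  exact (hβ _ inter_subset_left _ _ (contVectorFieldOn_chartFrame p inter_subset_right
    (continuousOn_const (c := u))) (contVectorFieldOn_chartFrame p inter_subset_right
    (continuousOn_const (c := v)))).comp (continuousOn_chartParam p V) (mapsTo_chartDomain p V)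

theorem uniqueDiffOn_unitSquare : UniqueDiffOn ℝ unitSquare :=
  (uniqueDiffOn_Icc_zero_one).prod uniqueDiffOn_Icc_zero_one

/-- The 2-cell in `V` with the expression `σ` in the chart at `p`. -/
def chartCell (p : M) (V : Set M) (σ : ℝ × ℝ → Model d) (hσ : ContDiff ℝ 1 σ)
    (hm : MapsTo σ unitSquare (chartDomain p V)) : Cell2 d V where
  toFun := chartParam d p ∘ σ
  contMDiffOn := (contMDiffOn_chartParam p).comp hσ.contMDiff.contMDiffOn fun _ hz => (hm hz).1
  mapsTo _ hz := (hm hz).2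

theorem mfderivWithin_chartParam_comp {F : Type*} [NormedAddCommGroup F] [NormedSpace ℝ F] (p : M)
    {σ : F → Model d} {s : Set F} (hs : UniqueDiffOn ℝ s) {z : F} (hz : z ∈ s)
    {σ' : F →L[ℝ] Model d} (hσ : HasFDerivAt σ σ' z) (hm : σ z ∈ (extChartAt (𝓡 d) p).target)
    (v : F) :
    mfderivWithin 𝓘(ℝ, F) (𝓡 d) (chartParam d p ∘ σ) s z v =
      chartFrame p (chartParam d p (σ z)) (σ' v) := by
  have h1 := (hasMFDerivAt_chartParam p hm).comp_hasMFDerivWithinAt z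
    (hσ.hasFDerivWithinAt (s := s)).hasMFDerivWithinAt
  rw [h1.mfderivWithin (hs.uniqueMDiffOn z hz)]
  rfl

theorem IsContExtDifferential.stokesOn_pull {η : OneForm d M} {β : TwoForm d M} {V : Set M}
    (h : IsContExtDifferential η β V) (p : M) :
    StokesOn (η.pull p) (β.pull p) (chartDomain p V) := by
  intro σ hσ hm
  set c := chartCell p V σ hσ hm with hc
  have hst := h.stokes _ (Finsupp.single c 1) rfl
  have hadd : ∀ a b : Chain1 d V, (a + b).integral η = a.integral η + b.integral η := fun a b =>
    Finsupp.sum_add_index' (by simp) (by intros; push_cast; ring)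
  have hsub : ∀ a b : Chain1 d V, (a - b).integral η = a.integral η - b.integral η := fun a b =>
    Finsupp.sum_sub_index (by intros; push_cast; ring)
  have hsingle : ∀ a : Cell1 d V, Chain1.integral (Finsupp.single a 1) η = a.integral η :=
    fun a => by simp [Chain1.integral]
  rw [Chain2.boundary, Finsupp.sum_single_index (by simp), one_smul, Chain2.integral,
    Finsupp.sum_single_index (by simp), Cell2.boundary, hsub, hsub, hadd, hsingle, hsingle,
    hsingle, hsingle] at hst
  have hd : ∀ z, HasFDerivAt σ (fderiv ℝ σ z) z := fun z =>
    (hσ.differentiable one_ne_zero z).hasFDerivAt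
  have hedge : ∀ (g : ℝ → ℝ × ℝ) (g' : ℝ × ℝ) (hg : ContDiff ℝ 1 g)
      (hgm : MapsTo g (Icc 0 1) unitSquare), (∀ t, HasDerivAt g g' t) →
      (c.edge g hg hgm).integral η =
        ∫ t in Icc (0 : ℝ) 1, η.pull p (σ (g t)) (fderiv ℝ σ (g t) g') := by
    intro g g' hg hgm hg'
    refine setIntegral_congr_fun measurableSet_Icc fun t ht => ?_
    have h1 := mfderivWithin_chartParam_comp p uniqueDiffOn_Icc_zero_one ht
      ((hd (g t)).comp t (hg' t).hasFDerivAt) (hm (hgm ht)).1 1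
    refine (congrArg (η (chartParam d p (σ (g t)))) h1).trans ?_
    simp [OneForm.pull]
  have e₁ : c.bottom.integral η = _ := hedge _ (1, 0) _ _ fun t =>
    (hasDerivAt_id' t).prodMk (hasDerivAt_const t (0 : ℝ))
  have e₂ : c.right.integral η = _ := hedge _ (0, 1) _ _ fun t =>
    (hasDerivAt_const t (1 : ℝ)).prodMk (hasDerivAt_id' t)
  have e₃ : c.top.integral η = _ := hedge _ (1, 0) _ _ fun t =>
    (hasDerivAt_id' t).prodMk (hasDerivAt_const t (1 : ℝ))
  have e₄ : c.left.integral η = _ := hedge _ (0, 1) _ _ fun t =>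
    (hasDerivAt_const t (0 : ℝ)).prodMk (hasDerivAt_id' t)
  rw [e₁, e₂, e₃, e₄] at hst
  rw [hst, Int.cast_one, one_mul]
  refine setIntegral_congr_fun (measurableSet_Icc.prod measurableSet_Icc) fun z hz => ?_
  have h1 := mfderivWithin_chartParam_comp p uniqueDiffOn_unitSquare hz (hd z) (hm hz).1
  rw [TwoForm.pull_apply]
  refine congrArg (β (chartParam d p (σ z))) ?_
  exact congrArg₂ (fun a b => ![a, b]) (h1 (1, 0)) (h1 (0, 1))

end Charts

/-! ### Reparametrization and concatenation -/

section Reparametrization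

/-- The change of parameter by arc length for a curve on `[0,1]` with speed `n`: the inverse `θ` of
a primitive of `n`, which maps `[0,T]`, where `T` is the length, to `[0,1]`. The lower bound of the
speed makes the primitive surjective. -/
theorem exists_reparametrization {n : ℝ → ℝ} (hn : Continuous n) {m : ℝ} (hm : 0 < m)
    (hmn : ∀ t, m ≤ n t) :
    ∃ (θ : ℝ → ℝ) (T : ℝ), 0 ≤ T ∧ θ 0 = 0 ∧ θ T = 1 ∧ ContDiff ℝ 1 θ ∧
      MapsTo θ (Icc 0 T) (Icc 0 1) ∧ ∀ x, HasDerivAt θ (n (θ x))⁻¹ x := by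
  let s : ℝ → ℝ := fun t => ∫ x in (0 : ℝ)..t, n x
  have hs : ∀ t, HasDerivAt s (n t) t := fun t => (hn.integral_hasStrictDerivAt 0 t).hasDerivAt
  have hpos : ∀ t, 0 < n t := fun t => hm.trans_le (hmn t)
  have hmono : StrictMono s := strictMono_of_deriv_pos fun t => by rw [(hs t).deriv]; exact hpos t
  have hcont : Continuous s := continuous_iff_continuousAt.2 fun t => (hs t).continuousAt
  have hs0 : s 0 = 0 := by simp [s]
  -- `s t - m t` is monotone and vanishes at `0`
  have hmono' : Monotone fun t => s t - m * t := by
    have hd : ∀ t, HasDerivAt (fun t => s t - m * t) (n t - m) t := fun t =>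
      ((hs t).sub ((hasDerivAt_id' t).const_mul m)).congr_deriv (by rw [mul_one])
    refine monotone_of_deriv_nonneg (fun t => (hd t).differentiableAt) fun t => ?_
    rw [(hd t).deriv]
    linarith [hmn t]
  have htop : Tendsto s atTop atTop := by
    refine tendsto_atTop_mono' _ ?_ (tendsto_id.const_mul_atTop hm)
    filter_upwards [eventually_ge_atTop (0 : ℝ)] with t ht
    have := hmono' ht
    simp only [hs0, mul_zero, sub_zero] at this
    simp only [id]
    linarith
  have hbot : Tendsto s atBot atBot := by
    refine tendsto_atBot_mono' _ ?_ (tendsto_id.const_mul_atBot hm)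
    filter_upwards [eventually_le_atBot (0 : ℝ)] with t ht
    have := hmono' ht
    simp only [hs0, mul_zero, sub_zero] at this
    simp only [id]
    linarith
  let f : ℝ ≃o ℝ := hmono.orderIsoOfSurjective s (hcont.surjective htop hbot)
  have hf : ∀ t, f t = s t := fun t => rfl
  have hθd : ∀ x, HasDerivAt f.symm (n (f.symm x))⁻¹ x := fun x =>
    HasDerivAt.of_local_left_inverse f.symm.continuous.continuousAt (hs (f.symm x))
      (hpos _).ne' (Eventually.of_forall fun y => f.apply_symm_apply y)
  have hθ0 : f.symm 0 = 0 := by rw [OrderIso.symm_apply_eq, hf, hs0]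
  have hθ1 : f.symm (s 1) = 1 := by rw [OrderIso.symm_apply_eq, hf]
  refine ⟨f.symm, s 1, ?_, hθ0, hθ1, ?_, fun x hx => ?_, hθd⟩
  · rw [← hs0]; exact hmono.monotone zero_le_one
  · rw [contDiff_one_iff_deriv]
    refine ⟨fun x => (hθd x).differentiableAt, ?_⟩
    rw [show deriv f.symm = fun x => (n (f.symm x))⁻¹ from funext fun x => (hθd x).deriv]
    exact (hn.comp f.symm.continuous).inv₀ fun x => (hpos _).ne'
  · rw [← hθ0, ← hθ1]
    exact ⟨f.symm.monotone hx.1, f.symm.monotone hx.2⟩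

end Reparametrization

section Paths
variable {d r : ℕ} {M : Type*} [TopologicalSpace M] [ChartedSpace (Model d) M]
  [IsManifold (𝓡 d) ∞ M] {Δ : ContSubbundle d M r}

/-- `v` belongs to `Δ` and has length one. -/
def ContSubbundle.Metric.IsUnitVector (g : Δ.Metric) (q : M) (v : Tan d q) : Prop :=
  ∃ h : v ∈ Δ.fiber q, g.form q ⟨v, h⟩ ⟨v, h⟩ = 1

/-- `p` and `q` are joined by a `C¹` arc which is tangent to `Δ` and parametrized by length. No
condition is imposed on the two-sided velocity at the end points. -/
def ContSubbundle.Metric.UnitArc (g : Δ.Metric) (p q : M) : Prop :=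
  ∃ (T : ℝ) (γ : ℝ → M), 0 ≤ T ∧ γ 0 = p ∧ γ T = q ∧
    ContMDiffOn 𝓘(ℝ, ℝ) (𝓡 d) 1 γ (Icc 0 T) ∧
    ∀ t ∈ Ioo 0 T, g.IsUnitVector (γ t) (velocity d γ t)

/-- The velocity of a path, including the fibre to which it belongs, is a local notion. -/
theorem ContSubbundle.Metric.isUnitVector_velocity_congr (g : Δ.Metric) {γ γ' : ℝ → M} {t : ℝ}
    (h : γ =ᶠ[𝓝 t] γ') (h' : g.IsUnitVector (γ' t) (velocity d γ' t)) :
    g.IsUnitVector (γ t) (velocity d γ t) := by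
  have h1 : γ t = γ' t := h.eq_of_nhds
  have h2 : (velocity d γ t : Model d) = velocity d γ' t := by
    unfold velocity
    rw [h.mfderiv_eq]
    rfl
  have h3 : ∀ (a b : M) (v w : Model d), a = b → v = w →
      g.IsUnitVector b w → g.IsUnitVector a v := by
    rintro a _ v _ rfl rfl h
    exact h
  exact h3 _ _ _ _ h1 h2 h'

omit [IsManifold (𝓡 d) ∞ M] in
theorem velocity_comp_sub_const {γ : ℝ → M} {a t : ℝ}
    (h : MDifferentiableAt 𝓘(ℝ, ℝ) (𝓡 d) γ (t - a)) :
    velocity d (fun t => γ (t - a)) t = velocity d γ (t - a) := by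
  have h1 : HasDerivAt (fun t : ℝ => t - a) 1 t := (hasDerivAt_id t).sub_const a
  have h2 := h.hasMFDerivAt.comp t h1.hasFDerivAt.hasMFDerivAt
  unfold velocity
  refine (congrArg (fun L => L (1 : ℝ)) h2.mfderiv).trans ?_
  change mfderiv 𝓘(ℝ, ℝ) (𝓡 d) γ (t - a) _ = _
  congr 1
  exact one_smul ℝ (1 : ℝ)

/-- Chains of unit arcs are concatenated to a piecewise `C¹` path. -/
theorem ContSubbundle.Metric.exists_path_of_reflTransGen (g : Δ.Metric) {p q : M}
    (h : Relation.ReflTransGen g.UnitArc p q) :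
    ∃ (T : ℝ) (γ : ℝ → M), 0 ≤ T ∧ γ 0 = p ∧ γ T = q ∧ PiecewiseC1 d γ T ∧
      ∀ᵐ t, t ∈ Icc 0 T → g.IsUnitVector (γ t) (velocity d γ t) := by
  induction h with
  | refl =>
    refine ⟨0, fun _ => p, le_rfl, rfl, rfl, ⟨continuousOn_const, 0, fun _ => 0, monotone_const,
      rfl, rfl, by simp⟩, ?_⟩
    filter_upwards [Measure.ae_ne volume 0] with t ht h
    exact absurd (le_antisymm h.2 h.1) ht
  | @tail b c _ hbc ih =>
    obtain ⟨T₁, γ₁, hT₁, h0, h1, ⟨hc, k, τ, hτ, hτ0, hτk, hC⟩, hu⟩ := ih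
    obtain ⟨T₂, γ₂, hT₂, k0, k1, kC, ku⟩ := hbc
    set γ : ℝ → M := fun t => if t ≤ T₁ then γ₁ t else γ₂ (t - T₁) with hγ
    have e₁ : EqOn γ γ₁ (Iic T₁) := fun t ht => if_pos ht
    have e₂ : EqOn γ (fun t => γ₂ (t - T₁)) (Ici T₁) := fun t ht => by
      rcases eq_or_lt_of_le (show T₁ ≤ t from ht) with rfl | hlt
      · simp [hγ, h1, k0]
      · exact if_neg (not_le.2 hlt)
    have s₁ : Icc 0 T₁ ⊆ Iic T₁ := fun t ht => ht.2
    have s₂ : Icc T₁ (T₁ + T₂) ⊆ Ici T₁ := fun t ht => ht.1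
    have kC' : ContMDiffOn 𝓘(ℝ, ℝ) (𝓡 d) 1 γ (Icc T₁ (T₁ + T₂)) := by
      refine ContMDiffOn.congr ?_ (e₂.mono s₂)
      refine kC.comp (t := Icc 0 T₂) (f := fun t => t - T₁) ?_ fun t ht => ?_
      · exact (contDiff_id.sub contDiff_const).contMDiff.contMDiffOn
      · exact ⟨by linarith [ht.1], by linarith [ht.2]⟩
    refine ⟨T₁ + T₂, γ, by linarith, (e₁ hT₁).trans h0, ?_, ⟨?_, k + 1,
      fun i => if i ≤ k then τ i else T₁ + T₂, ?_, ?_, ?_, fun i hi => ?_⟩, ?_⟩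
    · rw [e₂ (show T₁ ≤ T₁ + T₂ by linarith)]
      simp [k1]
    · rw [← Icc_union_Icc_eq_Icc hT₁ (by linarith : T₁ ≤ T₁ + T₂)]
      exact (hc.congr (e₁.mono s₁)).union_of_isClosed kC'.continuousOn isClosed_Icc isClosed_Icc
    · refine monotone_nat_of_le_succ fun i => ?_
      rcases lt_trichotomy i k with h | rfl | h
      · simp only [h.le, Nat.succ_le_of_lt h, if_true]
        exact hτ (Nat.le_succ i)
      · simp [hτk, hT₂]
      · simp [not_le.2 h, not_le.2 (h.trans (Nat.lt_succ_self i))]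
    · simp [hτ0]
    · simp
    · rcases Nat.lt_succ_iff_lt_or_eq.1 hi with h | rfl
      · simp only [h.le, Nat.succ_le_of_lt h, if_true]
        refine (hC i h).congr (e₁.mono fun t ht => ?_)
        exact ht.2.trans ((hτ (Nat.succ_le_of_lt h)).trans hτk.le)
      · simpa [hτk] using kC'
    · filter_upwards [hu, Measure.ae_ne volume T₁,
        Measure.ae_ne volume (T₁ + T₂)] with t ht n₁ n₂ hmem
      rcases lt_or_gt_of_ne n₁ with hlt | hgt
      · refine g.isUnitVector_velocity_congr ?_ (ht ⟨hmem.1, hlt.le⟩)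
        filter_upwards [Iic_mem_nhds hlt] with x hx using e₁ hx
      · have hI : t - T₁ ∈ Ioo 0 T₂ :=
          ⟨by linarith, by linarith [lt_of_le_of_ne hmem.2 n₂]⟩
        refine g.isUnitVector_velocity_congr (γ' := fun t => γ₂ (t - T₁)) ?_ ?_
        · filter_upwards [Ici_mem_nhds hgt] with x hx using e₂ hx
        · have hd : MDifferentiableAt 𝓘(ℝ, ℝ) (𝓡 d) γ₂ (t - T₁) :=
            (kC.contMDiffAt (Icc_mem_nhds hI.1 hI.2)).mdifferentiableAt one_ne_zero
          have := ku _ hI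
          rwa [← velocity_comp_sub_const hd] at this

end Paths

/-! ### Accessibility -/

section Accessibility

/-- If the wedge product of a covector `l` and an alternating bilinear form `β` does not vanish,
then `β` does not vanish on the kernel of `l`. -/
theorem exists_transverse_of_wedge_ne_zero {E : Type*} [NormedAddCommGroup E] [NormedSpace ℝ E]
    {l : E →L[ℝ] ℝ} {β : E →L[ℝ] E →L[ℝ] ℝ} (hβ : ∀ x, β x x = 0) {x y z : E}
    (h : l x * β y z - l y * β x z + l z * β x y ≠ 0) :
    ∃ e u v, l e = 1 ∧ l u = 0 ∧ l v = 0 ∧ β u v ≠ 0 := by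
  have hl : ∃ a, l a ≠ 0 := by
    by_contra! hl
    simp [hl] at h
  obtain ⟨a, ha⟩ := hl
  have he : l ((l a)⁻¹ • a) = 1 := by simp [ha]
  set e := (l a)⁻¹ • a
  have hanti : ∀ x y, β x y = -β y x := fun x y => by
    have := hβ (x + y)
    simp only [map_add, add_apply, hβ] at this
    linarith
  by_contra! hno
  have hker : ∀ x, l (x - l x • e) = 0 := fun x => by simp [he]
  -- on the kernel of `l` the form `β` vanishes, so `β` is the product of `l` and a covector
  have hform : ∀ x y, β x y = l x * β e y - l y * β e x := fun x y => by
    have h1 := hno e _ _ he (hker x) (hker y)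
    simp only [map_sub, map_smul, sub_apply, smul_apply, smul_eq_mul, hβ] at h1
    have h2 := hanti x e
    rw [h2] at h1
    linarith
  apply h
  rw [hform x y, hform x z, hform y z]
  ring

variable {n : ℕ} {M : Type*} [TopologicalSpace M] [ChartedSpace (Model (n + 1)) M]
  [IsManifold (𝓡 (n + 1)) ∞ M] {Δ : ContSubbundle (n + 1) M n}

/-- A nonzero covector that annihilates the corank one subspace `Δ q` has kernel `Δ q`. -/
theorem ContSubbundle.mem_fiber_of_apply_eq_zero (Δ : ContSubbundle (n + 1) M n) {q : M}
    {l : Tan (n + 1) q →L[ℝ] ℝ} (hl : l ≠ 0) (hΔ : ∀ v ∈ Δ.fiber q, l v = 0)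
    {v : Tan (n + 1) q} (hv : l v = 0) : v ∈ Δ.fiber q := by
  obtain ⟨U, -, hqU, X, -, hX⟩ := Δ.exists_frame q
  obtain ⟨hli, hspan⟩ := hX q hqU
  have : FiniteDimensional ℝ (Tan (n + 1) q) :=
    inferInstanceAs (FiniteDimensional ℝ (Model (n + 1)))
  have hdim : Module.finrank ℝ (Tan (n + 1) q) = n + 1 :=
    finrank_euclideanSpace_fin (𝕜 := ℝ) (n := n + 1)
  have h1 : Module.finrank ℝ (Δ.fiber q) = n := by
    rw [← hspan, finrank_span_eq_card hli, Fintype.card_fin]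
  have h2 : Module.finrank ℝ (LinearMap.ker l.toLinearMap) = n := by
    have hr : LinearMap.range l.toLinearMap = ⊤ :=
      LinearMap.range_eq_top.2 (LinearMap.surjective fun h0 => hl (by
        ext x
        exact congrArg (fun L : Tan (n + 1) q →ₗ[ℝ] ℝ => L x) h0))
    have h3 := LinearMap.finrank_range_add_finrank_ker l.toLinearMap
    rw [hr, finrank_top, Module.finrank_self, hdim] at h3
    omega
  have hle : Δ.fiber q ≤ LinearMap.ker l.toLinearMap := fun x hx => hΔ x hx
  rw [Submodule.eq_of_le_of_finrank_eq hle (h1.trans h2.symm)]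
  exact hv

/-- In the chart at `p`, lifts of constant vectors describe unit arcs after reparametrization. -/
theorem IsLift.unitArc (g : Δ.Metric) {p : M} (D : Δ.ExtDifferentialAt p) {S : Set (Model (n + 1))}
    {e w y y' : Model (n + 1)} {γ : ℝ → Model (n + 1)} (hS : S ⊆ chartDomain p D.V)
    (he : ∀ z ∈ S, 0 < D.η.pull p z e) (hγ : IsLift (D.η.pull p) e S w y y' γ) :
    g.UnitArc (chartParam (n + 1) p y) (chartParam (n + 1) p y') := by
  by_cases hw : ∃ c : ℝ, w = c • e
  · -- the lift of a multiple of `e` is constant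
    obtain ⟨c, rfl⟩ := hw
    have h1 := hγ.norm_sub_le (x := 0) (C := 0) (fun z hz => by
      have := (he z hz).ne'
      simp only [liftVec, map_smul, smul_eq_mul, sub_zero, norm_le_zero_iff]
      rw [mul_left_comm, inv_mul_cancel₀ this, mul_one, sub_self]) (t := 1) (by simp)
    rw [hγ.target, smul_zero, sub_zero, norm_le_zero_iff, sub_eq_zero] at h1
    subst h1
    exact ⟨0, fun _ => chartParam (n + 1) p y', le_rfl, rfl, rfl, contMDiffOn_const, by simp⟩
  have hlv : ∀ z, liftVec (D.η.pull p) e w z ≠ 0 := fun z hz => hw ⟨_, sub_eq_zero.1 hz⟩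
  set φ := extChartAt (𝓡 (n + 1)) p with hφ
  have hφψ : ∀ z ∈ S, φ (chartParam (n + 1) p z) = z := fun z hz => φ.right_inv (hS hz).1
  set W : Set M := {q ∈ (chartAt (Model (n + 1)) p).source | φ q ∈ S} with hW
  have hψW : ∀ z ∈ S, chartParam (n + 1) p z ∈ W := fun z hz =>
    ⟨chartParam_mem_source p (hS hz).1, by rw [hφψ z hz]; exact hz⟩
  set X : ∀ q : M, Tan (n + 1) q := fun q => chartFrame p q (liftVec (D.η.pull p) e w (φ q)) with hX
  have hXψ : ∀ z ∈ S, X (chartParam (n + 1) p z) =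
      chartFrame p (chartParam (n + 1) p z) (liftVec (D.η.pull p) e w z) := fun z hz => by
    simp only [hX, hφψ z hz]
  have hXmem : ∀ z ∈ S, X (chartParam (n + 1) p z) ∈ Δ.fiber (chartParam (n + 1) p z) := by
    intro z hz
    have hz0 := (he z hz).ne'
    refine Δ.mem_fiber_of_apply_eq_zero (l := D.η (chartParam (n + 1) p z)) ?_
      (D.basis.mem.2 _ (hS hz).2) ?_
    · intro h0
      apply hz0
      simp [OneForm.pull, h0]
    · rw [hXψ z hz]
      change D.η.pull p z (liftVec (D.η.pull p) e w z) = 0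
      simp only [liftVec, map_sub, map_smul, smul_eq_mul]
      field_simp
      ring
  have hWψ : ∀ q ∈ W, chartParam (n + 1) p (φ q) = q := fun q hq =>
    φ.left_inv (by rw [hφ, extChartAt_source]; exact hq.1)
  have hXW : ∀ q ∈ W, X q ∈ Δ.fiber q := fun q hq => by
    have := hXmem (φ q) hq.2
    rwa [hWψ q hq] at this
  have hXne : ∀ q ∈ W, X q ≠ 0 := fun q hq h0 => by
    refine hlv (φ q) (chartFrame_injective p hq.1 ?_)
    rw [map_zero]
    exact h0
  have hXc : ContVectorFieldOn X W := by
    refine contVectorFieldOn_chartFrame p (fun q hq => hq.1) ?_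
    have h1 : ∀ x, ContinuousOn (fun z => D.η.pull p z x) S := fun x =>
      ((D.isDifferential.cont_form.pull p).mono hS).clm_apply continuousOn_const
    have h2 : ContinuousOn (liftVec (D.η.pull p) e w) S := continuousOn_const.sub
      ((((h1 e).inv₀ fun z hz => (he z hz).ne').mul (h1 w)).smul continuousOn_const)
    refine h2.comp ((continuousOn_extChartAt p).mono fun q hq => ?_) fun q hq => hq.2
    rw [extChartAt_source]
    exact hq.1
  classical
  let Y : ∀ q : M, Δ.fiber q := fun q => if h : X q ∈ Δ.fiber q then ⟨X q, h⟩ else 0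
  have hY : ∀ q (h : X q ∈ Δ.fiber q), Y q = ⟨X q, h⟩ := fun q h => dif_pos h
  have hYc : ContVectorFieldOn (fun q => (Y q : Tan (n + 1) q)) W :=
    ContinuousOn.congr hXc fun q hq => by simp only [hY q (hXW q hq)]
  have hNc := g.cont W Y Y hYc hYc
  have hNpos : ∀ q ∈ W, 0 < g.form q (Y q) (Y q) := fun q hq => by
    refine g.pos q _ fun h0 => hXne q hq ?_
    rw [hY q (hXW q hq)] at h0
    exact congrArg Subtype.val h0
  -- the speed of the lift, extended to the line
  let N : ℝ → ℝ := fun t => √(g.form (chartParam (n + 1) p (γ t)) (Y _) (Y _))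
  have hNI : ContinuousOn N (Icc 0 1) := by
    refine Real.continuous_sqrt.comp_continuousOn
      (hNc.comp (f := fun t => chartParam (n + 1) p (γ t)) ?_ fun t ht => hψW _ (hγ.mem t ht))
    exact (continuousOn_chartParam p D.V).comp hγ.contDiff.continuous.continuousOn
      fun t ht => hS (hγ.mem t ht)
  have hN0 : ∀ t ∈ Icc (0 : ℝ) 1, 0 < N t := fun t ht =>
    Real.sqrt_pos.2 (hNpos _ (hψW _ (hγ.mem t ht)))
  -- the lift is reparametrized by arc length
  obtain ⟨t₀, ht₀, hmin⟩ := isCompact_Icc.exists_isMinOn (nonempty_Icc.2 (zero_le_one (α := ℝ))) hNI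
  obtain ⟨θ, T, hT, hθ0, hθT, hθc, hθm, hθd⟩ := exists_reparametrization
    (n := IccExtend (zero_le_one (α := ℝ)) ((Icc (0 : ℝ) 1).domRestrict N))
    (hNI.domRestrict.Icc_extend') (hN0 t₀ ht₀) fun t => hmin (projIcc 0 1 zero_le_one t).2
  refine ⟨T, fun x => chartParam (n + 1) p (γ (θ x)), hT, by simp only [hθ0, hγ.source],
    by simp only [hθT, hγ.target], ?_, fun x hx => ?_⟩
  · refine (contMDiffOn_chartParam p).comp (t := (extChartAt (𝓡 (n + 1)) p).target)
      (f := fun x => γ (θ x)) (hγ.contDiff.comp hθc).contMDiff.contMDiffOn fun x hx => ?_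
    exact (hS (hγ.mem _ (hθm hx))).1
  · have hθx := hθm (Ioo_subset_Icc_self hx)
    have hzS := hγ.mem _ hθx
    set z := γ (θ x) with hz
    have hd : HasDerivAt (fun x => γ (θ x)) ((N (θ x))⁻¹ • liftVec (D.η.pull p) e w z) x := by
      have h1 := (hγ.hasDerivAt _ hθx).scomp x (hθd x)
      rwa [IccExtend_of_mem _ _ hθx] at h1
    have hvel : velocity (n + 1) (fun x => chartParam (n + 1) p (γ (θ x))) x =
        (N (θ x))⁻¹ • X (chartParam (n + 1) p z) := by
      have h2 := (hasMFDerivAt_chartParam p (hS hzS).1).comp x hd.hasFDerivAt.hasMFDerivAt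
      refine (congrArg (fun L => L (1 : ℝ)) h2.mfderiv).trans ?_
      rw [hXψ z hzS, ← map_smul]
      change chartFrame p (chartParam (n + 1) p z) _ = _
      congr 1
      exact one_smul ℝ _
    have hXz := hXmem z hzS
    have hpos := hN0 _ hθx
    have hsq : N (θ x) * N (θ x) =
        g.form (chartParam (n + 1) p z) ⟨X (chartParam (n + 1) p z), hXz⟩ ⟨_, hXz⟩ := by
      rw [← hY _ hXz]
      exact Real.mul_self_sqrt (hNpos _ (hψW _ hzS)).le
    change g.IsUnitVector (chartParam (n + 1) p z) _
    rw [hvel]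
    refine ⟨Submodule.smul_mem _ _ hXz, ?_⟩
    have h3 : (⟨(N (θ x))⁻¹ • X (chartParam (n + 1) p z), Submodule.smul_mem _ _ hXz⟩ :
        Δ.fiber (chartParam (n + 1) p z)) = (N (θ x))⁻¹ • ⟨X (chartParam (n + 1) p z), hXz⟩ := rfl
    rw [h3, map_smul, map_smul, LinearMap.smul_apply, smul_eq_mul, smul_eq_mul, ← hsq]
    field_simp

/-- Points near `p` are joined with `p` by chains of unit arcs in both directions. -/
theorem eventually_reflTransGen_unitArc (g : Δ.Metric) {p : M} (D : Δ.ExtDifferentialAt p)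
    (hD : D.NonIntegrable) :
    ∀ᶠ q in 𝓝 p, Relation.ReflTransGen g.UnitArc p q ∧ Relation.ReflTransGen g.UnitArc q p := by
  set φ := extChartAt (𝓡 (n + 1)) p with hφ
  have hp : chartParam (n + 1) p (φ p) = p := extChartAt_to_inv p
  have hy₀ : φ p ∈ chartDomain p D.V :=
    ⟨mem_extChartAt_target p, by rw [mem_preimage, hp]; exact D.mem⟩
  have halt : ∀ x, D.dη.pull p (φ p) x x = 0 := fun x => by
    rw [TwoForm.pull_apply]
    exact (D.dη _).map_eq_zero_of_eq _ (i := 0) (j := 1) rfl (by decide)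
  obtain ⟨x, y, z, hxyz⟩ : ∃ x y z, wedge D.η D.dη (chartParam (n + 1) p (φ p)) x y z ≠ 0 := by
    rw [hp]
    exact hD
  have hsurj := chartFrame_surjective p (chartParam_mem_source p hy₀.1)
  obtain ⟨x, rfl⟩ := hsurj x
  obtain ⟨y, rfl⟩ := hsurj y
  obtain ⟨z, rfl⟩ := hsurj z
  simp only [wedge, ← TwoForm.pull_apply] at hxyz
  obtain ⟨e, u, v, he, hu, hv, huv⟩ :=
    exists_transverse_of_wedge_ne_zero (l := D.η.pull p (φ p)) halt hxyz
  obtain ⟨S, hS, hSe, hreach⟩ := exists_nhds_liftReachable (isOpen_chartDomain p D.isOpen)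
    (D.isDifferential.cont_form.pull p) (D.isDifferential.cont_differential.pull p)
    (D.isDifferential.stokesOn_pull p) hy₀ he halt hu hv huv
  have hlift : ∀ y y', LiftReachable (D.η.pull p) e S y y' → Relation.ReflTransGen g.UnitArc
      (chartParam (n + 1) p y) (chartParam (n + 1) p y') := fun y y' h =>
    Relation.ReflTransGen.lift (p := g.UnitArc)
      (chartParam (n + 1) p) (fun _ _ ⟨_, _, hγ⟩ => hγ.unitArc g D hS hSe) _ _ h
  filter_upwards [(continuousAt_extChartAt p).eventually hreach,
    extChartAt_source_mem_nhds (I := 𝓡 (n + 1)) p] with q hq hqs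
  have hq' : chartParam (n + 1) p (φ q) = q := φ.left_inv hqs
  have h1 := hlift _ _ hq
  have h2 := hlift _ _ hq.symm
  rw [hp, hq'] at h1 h2
  exact ⟨h1, h2⟩

/-- On a connected manifold, local reachability implies reachability of all points. -/
theorem reflTransGen_unitArc [ConnectedSpace M] (g : Δ.Metric) (D : ∀ p : M, Δ.ExtDifferentialAt p)
    (hD : ∀ p, (D p).NonIntegrable) (p q : M) : Relation.ReflTransGen g.UnitArc p q := by
  have hloc := fun p => eventually_reflTransGen_unitArc g (D p) (hD p)
  have hclopen : IsClopen {q | Relation.ReflTransGen g.UnitArc p q} := by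
    refine ⟨isOpen_compl_iff.1 (isOpen_iff_mem_nhds.2 fun q hq => ?_),
      isOpen_iff_mem_nhds.2 fun q hq => ?_⟩
    · filter_upwards [hloc q] with x hx hpx
      exact hq (Relation.ReflTransGen.trans hpx hx.2)
    · filter_upwards [hloc q] with x hx
      exact Relation.ReflTransGen.trans hq hx.1
  exact eq_univ_iff_forall.1 (hclopen.eq_univ ⟨p, Relation.ReflTransGen.refl⟩) q

end Accessibility
end ContSubRiem
end

theorem mainTheorem3 (n : ℕ) (hn : 2 ≤ n) {M : Type*} [TopologicalSpace M] [T2Space M]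
    [SecondCountableTopology M] [ConnectedSpace M]
    [ChartedSpace (ContSubRiem.Model (n + 1)) M] [IsManifold (𝓡 (n + 1)) ∞ M]
    (Δ : ContSubRiem.ContSubbundle (n + 1) M n) (g : Δ.Metric)
    (D : ∀ p : M, Δ.ExtDifferentialAt p) (hD : ∀ p : M, (D p).NonIntegrable) :
    Δ.IsAccessibleOn g Set.univ := by
  intro p _ q _
  obtain ⟨T, γ, hT, h0, h1, hC, hu⟩ := g.exists_path_of_reflTransGen
    (ContSubRiem.reflTransGen_unitArc g D hD p q)
  have hu' := (ae_restrict_iff' measurableSet_Icc).2 hu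
  exact ⟨T, γ, hT, h0, h1, ⟨hC, hu'.mono fun t ht => ht.1⟩, hu'⟩
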